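/- Let $r\ge 2$ and let $n,m\ge 1$ be coprime integers with $n>m$ if $r=2$ and $n\ge m$ if $r\ge 3$. For a finite $r$-uniform hypergraph $B$ with hyperedge set $R[B]$ put $\delta(B)=n|B|-m|R[B]|$; for $A\subseteq B$ write $A\le B$ if $\delta(A)\le\delta(B')$ whenever $A\subseteq B'\subseteq B$, and let $\mathcal C_0$ be the class of finite $B$ with $\delta(X)\ge 0$ for all $X\subseteq B$. For an $r$-uniform hypergraph $M$ all of whose finite substructures are in $\mathcal C_0$ and $C\subseteq M$, write $C\le M$ if $X\cap C\le X$ for all finite $X\subseteq M$. Let $M_0$ be the generic structure for $(\mathcal C_0,\le)$, that is, the countable $r$-uniform hypergraph, unique up to isomorphism, such that: all finite substructures of $M_0$ are in $\mathcal C_0$; $M_0$ is the union of a chain of finite subsets $F_i\le M_0$; and whenever $X\le M_0$ is finite and $X\le K\in\mathcal C_0$, there is an embedding $\alpha:K\to M_0$ that is the identity on $X$ with $\alpha(K)\le M_0$. For finite $X\subseteq M_0$ let $d(X)=\delta({\rm cl}_0(X))$, where ${\rm cl}_0(X)$ is the smallest $Y\le M_0$ containing $X$. For finite $X$ and arbitrary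 $Z\subseteq M_0$ let $d(X/Z)=\min\{d(X\cup Y)-d(Y): Y\subseteq Z \text{ finite}\}$, let ${\rm cl}^d(Z)=\{a\in M_0: d(\{a\}/Z)=0\}$, and let $\mathcal X=\{{\rm cl}^d(X): X\subseteq M_0\text{ finite}\}$; write ${\rm cl}^d(A,D)$ for ${\rm cl}^d(A\cup D)$. For $A\in\mathcal X$, an element $b$ of $M_0$ is basic over $A$ if $b\notin A$ and, for every $C\in\mathcal X$ with $A\subseteq C$, $d(b/C)<d(b/A)$ implies $b\in C$; and ${\rm orb}(b/A)$ is the orbit of $b$ under the automorphisms of $M_0$ that fix $A$ pointwise. Then, for every $A\in\mathcal X$ and every $u_0\in M_0$ that is basic over $A$, putting $D={\rm orb}(u_0/A)$, one has ${\rm cl}^d(A,D)=M_0$. In particular, $M_0$ is monodimensional: for every $A\in\mathcal X$ and every $b$ basic over $A$ there is $B\in\mathcal X$ with $A\subseteq B$ and ${\rm cl}^d(B,{\rm orb}(b/A))=M_0$. -/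

import Mathlib

/-- An `r`-uniform hypergraph on `V`: a symmetric `r`-ary relation that holds only of tuples of
distinct elements, given as the set of the `r`-element subsets on which it holds. -/
structure UniformHypergraph (r : ℕ) (V : Type*) where
  edges : Set (Finset V)
  card_eq : ∀ e ∈ edges, e.card = r

namespace UniformHypergraph

/-- The structure pulled back along an injection; for the inclusion of a subset it is the induced
substructure. An injection `f` is an embedding of `K` into `H` iff `H.comap f = K`. -/
def comap {r : ℕ} {V W : Type*} (H : UniformHypergraph r V) (f : W ↪ V) :
    UniformHypergraph r W where
  edges := {e | e.map f ∈ H.edges}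
  card_eq := fun e he => by simpa using H.card_eq _ he

/-- `R[S]`: the hyperedges contained in `S`. -/
def edgesIn {r : ℕ} {V : Type*} (H : UniformHypergraph r V) (S : Set V) : Set (Finset V) :=
  {e | e ∈ H.edges ∧ (e : Set V) ⊆ S}

/-- The predimension `δ(S) = n |S| - m |R[S]|` of a finite subset `S`
(only ever used for finite sets). -/
noncomputable def delta {r : ℕ} (n m : ℕ) {V : Type*} (H : UniformHypergraph r V) (S : Set V) : ℤ :=
  (n : ℤ) * S.ncard - (m : ℤ) * (H.edgesIn S).ncard

/-- All finite substructures have non-negative predimension. For finite `V` this is membership in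
the class `C₀`; in general it says that all finite substructures are in `C₀`. -/
def MemC0 {r : ℕ} (n m : ℕ) {V : Type*} (H : UniformHypergraph r V) : Prop :=
  ∀ S : Set V, S.Finite → 0 ≤ H.delta n m S

/-- `C ≤ V`: for every finite `X ⊆ V` one has `X ∩ C ≤ X`, that is, `δ(X ∩ C) ≤ δ(B)` whenever
`X ∩ C ⊆ B ⊆ X`. -/
def IsStrong {r : ℕ} (n m : ℕ) {V : Type*} (H : UniformHypergraph r V) (C : Set V) : Prop :=
  ∀ X : Set V, X.Finite → ∀ B : Set V, X ∩ C ⊆ B → B ⊆ X → H.delta n m (X ∩ C) ≤ H.delta n m B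

/-- `M` is the generic structure for `(C₀, ≤)`: it is countable, its finite substructures are in
`C₀`, it is the union of a chain of finite `≤`-substructures, and whenever a finite `X ≤ M` is
embedded by `j` as a `≤`-substructure of some `K` in `C₀`, there is an embedding `α` of `K` into
`M` over `X` whose image is `≤ M`. -/
structure IsGeneric {r : ℕ} (n m : ℕ) {V : Type*} (M : UniformHypergraph r V) : Prop where
  countable : Countable V
  memC0 : M.MemC0 n m
  chain : ∃ F : ℕ → Set V, Monotone F ∧ (∀ i, (F i).Finite ∧ M.IsStrong n m (F i)) ∧
    ⋃ i, F i = Set.univ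
  extension : ∀ X : Set V, X.Finite → M.IsStrong n m X →
    ∀ (B : Type) [Finite B] (K : UniformHypergraph r B), K.MemC0 n m →
    ∀ j : X ↪ B, K.comap j = M.comap (Function.Embedding.subtype (· ∈ X)) →
      K.IsStrong n m (Set.range j) →
      ∃ α : B ↪ V, M.comap α = K ∧ (∀ x : X, α (j x) = x) ∧ M.IsStrong n m (Set.range α)

/-- `cl₀(X)`: the smallest `≤`-substructure containing `X`. -/
def cl0 {r : ℕ} (n m : ℕ) {V : Type*} (M : UniformHypergraph r V) (X : Set V) : Set V :=
  ⋂₀ {Y | X ⊆ Y ∧ M.IsStrong n m Y}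

/-- The dimension `d(X) = δ(cl₀(X))` of a finite set `X`. -/
noncomputable def dim {r : ℕ} (n m : ℕ) {V : Type*} (M : UniformHypergraph r V) (X : Set V) : ℤ :=
  M.delta n m (M.cl0 n m X)

/-- The relative dimension `d(X/Z)` of a finite set `X` over an arbitrary set `Z`: the minimum of
`d(X/Y) = d(X ∪ Y) - d(Y)` over the finite subsets `Y` of `Z`. -/
noncomputable def relDim {r : ℕ} (n m : ℕ) {V : Type*} (M : UniformHypergraph r V)
    (X Z : Set V) : ℤ :=
  sInf {k | ∃ Y : Set V, Y.Finite ∧ Y ⊆ Z ∧ k = M.dim n m (X ∪ Y) - M.dim n m Y}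

/-- The `d`-closure `cl^d(Z)`. -/
def dcl {r : ℕ} (n m : ℕ) {V : Type*} (M : UniformHypergraph r V) (Z : Set V) : Set V :=
  {a | M.relDim n m {a} Z = 0}

/-- The collection of the `d`-closures of finite sets. -/
def finDcl {r : ℕ} (n m : ℕ) {V : Type*} (M : UniformHypergraph r V) : Set (Set V) :=
  {A | ∃ X : Set V, X.Finite ∧ A = M.dcl n m X}

/-- `b` is basic over `A`. -/
def IsBasic {r : ℕ} (n m : ℕ) {V : Type*} (M : UniformHypergraph r V) (A : Set V) (b : V) : Prop :=
  b ∉ A ∧ ∀ C ∈ M.finDcl n m, A ⊆ C → M.relDim n m {b} C < M.relDim n m {b} A → b ∈ C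

/-- `g` is an automorphism of `M`. -/
def IsAut {r : ℕ} {V : Type*} (M : UniformHypergraph r V) (g : Equiv.Perm V) : Prop :=
  M.comap g.toEmbedding = M

/-- `orb(b/A)`: the orbit of `b` under the automorphisms of `M` that fix every element of `A`. -/
def orb {r : ℕ} {V : Type*} (M : UniformHypergraph r V) (A : Set V) (b : V) : Set V :=
  {c | ∃ g : Equiv.Perm V, M.IsAut g ∧ (∀ a ∈ A, g a = a) ∧ g b = c}

/-- `M` is monodimensional: for every `A` in the collection of `d`-closures of finite sets and
every basic orbit `D` over `A`, some larger `B` in it satisfies `cl^d(B ∪ D) = M`. -/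
def Monodimensional {r : ℕ} (n m : ℕ) {V : Type*} (M : UniformHypergraph r V) : Prop :=
  ∀ A ∈ M.finDcl n m, ∀ b : V, M.IsBasic n m A b →
    ∃ B ∈ M.finDcl n m, A ⊆ B ∧ M.dcl n m (B ∪ M.orb A b) = Set.univ

end UniformHypergraph

/-! Let `A = dcl X` with `X` finite, and let `S` be the `d`-closure of `A` and the orbit of `u₀`. It
is `d`-closed and stable under the automorphisms fixing `A`. Dimensions over `A` are integers
bounded by `n`, so some `u ∈ S` has the largest one, `k`; its whole orbit lies in `S`, and `k > 0`
because `u₀ ∉ A`.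

The tool is `exists_attach`: to a finite strong set add `T` free copies of `u`, each raising `δ` by
`k`, and then one hyperedge, costing `m`, on these copies and `r - T` old points. Genericity
realises the result. By back-and-forth (`PartialAut.exists_isAut`) the new copies are conjugate to
`u` over `A`, hence in `S`, provided that the hyperedge leaves their closures strong.

If `k(r-1) < m`, hyperedges through `r-1` copies, alternating with hyperedges through new points,
keep the total dimension between `k+1` and `n` while the number of copies grows. More than `n`
copies cannot be independent, so their closure catches a point of dimension above `k`, against the
choice of `u` (`IsBase.exists_mem_dim_gt`).

So `m ≤ k(r-1)`. Then a hyperedge through `v` and `r-1` copies lowers the dimension of `v` over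
finite subsets of `S`, and repetition puts `v` in `S`, if `p = d(v/A)` satisfies `k + m ≤ p +
k(r-1)` (`IsBase.mem_of_dim_eq`). For `r ≥ 3` a free point has `p = n` and qualifies, which forces
`k ≥ n`; after that every point outside `A` qualifies. For `r = 2` the condition is `m ≤ p`, and a
point of smaller `p` is first made dependent on a point of dimension `p + n - m`
(`IsBase.exists_join`). -/

namespace UniformHypergraph

/-! ### Submodularity, strong sets and the finite closure -/

section Predimension

variable {r n m : ℕ} {V : Type*} (M : UniformHypergraph r V)

theorem edgesIn_finite {S : Set V} (hS : S.Finite) : (M.edgesIn S).Finite :=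
  (hS.toFinset.powerset.finite_toSet).subset fun e he => by
    simpa [Finset.subset_iff] using he.2

theorem edgesIn_inter (S T : Set V) : M.edgesIn (S ∩ T) = M.edgesIn S ∩ M.edgesIn T := by
  ext e
  simp only [edgesIn, Set.mem_ofPred_eq, Set.subset_inter_iff, Set.mem_inter_iff]
  tauto

theorem edgesIn_mono {S T : Set V} (h : S ⊆ T) : M.edgesIn S ⊆ M.edgesIn T :=
  fun _ he => ⟨he.1, he.2.trans h⟩

theorem delta_union_inter_of_edges {S T : Set V} (hS : S.Finite) (hT : T.Finite)
    (h : M.edgesIn (S ∪ T) ⊆ M.edgesIn S ∪ M.edgesIn T) :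
    M.delta n m (S ∪ T) + M.delta n m (S ∩ T) = M.delta n m S + M.delta n m T := by
  have h1 := Set.ncard_union_add_ncard_inter S T hS hT
  have h2 := Set.ncard_union_add_ncard_inter _ _ (M.edgesIn_finite hS) (M.edgesIn_finite hT)
  have h3 : M.edgesIn (S ∪ T) = M.edgesIn S ∪ M.edgesIn T :=
    h.antisymm (Set.union_subset (M.edgesIn_mono Set.subset_union_left)
      (M.edgesIn_mono Set.subset_union_right))
  rw [← h3, ← edgesIn_inter] at h2
  unfold delta
  zify at h1 h2
  linear_combination (n : ℤ) * h1 - (m : ℤ) * h2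

/-- Hyperedges of `S ∪ T` lying in neither set only lower the left side. -/
theorem delta_submodular {S T : Set V} (hS : S.Finite) (hT : T.Finite) :
    M.delta n m (S ∪ T) + M.delta n m (S ∩ T) ≤ M.delta n m S + M.delta n m T := by
  have h1 := Set.ncard_union_add_ncard_inter S T hS hT
  have h2 := Set.ncard_union_add_ncard_inter _ _ (M.edgesIn_finite hS) (M.edgesIn_finite hT)
  have h3 : (M.edgesIn S ∪ M.edgesIn T).ncard ≤ (M.edgesIn (S ∪ T)).ncard :=
    Set.ncard_le_ncard (Set.union_subset (M.edgesIn_mono Set.subset_union_left)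
      (M.edgesIn_mono Set.subset_union_right)) (M.edgesIn_finite (hS.union hT))
  rw [← edgesIn_inter] at h2
  unfold delta
  zify at h1 h2 h3
  have h4 := mul_le_mul_of_nonneg_left h3 (Int.natCast_nonneg m)
  have h5 := congrArg (fun x : ℤ => (n : ℤ) * x) h1
  have h6 := congrArg (fun x : ℤ => (m : ℤ) * x) h2
  simp only [mul_add] at h5 h6
  linarith

/-- Equality in submodularity leaves no hyperedge across the two sets. -/
theorem edgesIn_union_of_delta_le (hm : 1 ≤ m) {S T : Set V} (hS : S.Finite) (hT : T.Finite)
    (h : M.delta n m S + M.delta n m T ≤ M.delta n m (S ∪ T) + M.delta n m (S ∩ T)) :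
    M.edgesIn (S ∪ T) ⊆ M.edgesIn S ∪ M.edgesIn T := by
  have h1 := Set.ncard_union_add_ncard_inter S T hS hT
  have h2 := Set.ncard_union_add_ncard_inter _ _ (M.edgesIn_finite hS) (M.edgesIn_finite hT)
  have h3 : M.edgesIn S ∪ M.edgesIn T ⊆ M.edgesIn (S ∪ T) :=
    Set.union_subset (M.edgesIn_mono Set.subset_union_left)
      (M.edgesIn_mono Set.subset_union_right)
  rw [← edgesIn_inter] at h2
  refine (Set.eq_of_subset_of_ncard_le h3 ?_ (M.edgesIn_finite (hS.union hT))).ge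
  unfold delta at h
  zify at h1 h2 ⊢
  have h5 := congrArg (fun x : ℤ => (n : ℤ) * x) h1
  have h6 := congrArg (fun x : ℤ => (m : ℤ) * x) h2
  simp only [mul_add] at h5 h6
  have hm' : (0 : ℤ) < m := by exact_mod_cast hm
  refine le_of_mul_le_mul_left ?_ hm'
  linarith

/-- Submodularity passes from `B` to `B ∪ C`, so it suffices to test finite supersets of `C`. -/
theorem isStrong_of_delta_le {C : Set V} (hC : C.Finite)
    (h : ∀ B : Set V, B.Finite → C ⊆ B → M.delta n m C ≤ M.delta n m B) :
    M.IsStrong n m C := by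
  intro X hX B h1 h2
  have hB := hX.subset h2
  have h3 := M.delta_submodular (n := n) (m := m) hB hC
  have h4 := h (B ∪ C) (hB.union hC) Set.subset_union_right
  have h5 : B ∩ C = X ∩ C := by
    apply Set.Subset.antisymm
    · exact Set.inter_subset_inter_left _ h2
    · exact Set.subset_inter h1 Set.inter_subset_right
  rw [h5] at h3
  linarith

variable {M}

theorem IsStrong.delta_inter_le {C B : Set V} (h : M.IsStrong n m C) (hB : B.Finite) :
    M.delta n m (B ∩ C) ≤ M.delta n m B :=
  h B hB B Set.inter_subset_left subset_rfl

theorem IsStrong.delta_le {C B : Set V} (h : M.IsStrong n m C) (hB : B.Finite) (hCB : C ⊆ B) :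
    M.delta n m C ≤ M.delta n m B := by
  simpa [Set.inter_eq_right.2 hCB] using h.delta_inter_le hB

theorem IsStrong.inter {C D : Set V} (hC : M.IsStrong n m C) (hD : M.IsStrong n m D) :
    M.IsStrong n m (C ∩ D) := by
  intro X hX B h1 h2
  have hB := hX.subset h2
  refine le_trans ?_ (hC.delta_inter_le hB)
  have := hD (X ∩ C) (hX.subset Set.inter_subset_left) (B ∩ C) ?_ ?_
  · rwa [Set.inter_assoc] at this
  · rw [Set.inter_assoc]
    exact Set.subset_inter h1 (Set.inter_subset_right.trans Set.inter_subset_left)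
  · exact Set.inter_subset_inter_left _ h2

theorem subset_cl0 (X : Set V) : X ⊆ M.cl0 n m X :=
  Set.subset_sInter fun _ h => h.1

theorem cl0_subset {X C : Set V} (hC : M.IsStrong n m C) (h : X ⊆ C) : M.cl0 n m X ⊆ C :=
  Set.sInter_subset_of_mem ⟨h, hC⟩

/-- Among the finite supersets of `X` take one of least `δ`, which exists because `δ ≥ 0`, and of
least size among these. A strong set containing `X` meets it in another minimiser, hence contains
it. -/
theorem cl0_spec (hM : M.MemC0 n m) {X : Set V} (hX : X.Finite) :
    (M.cl0 n m X).Finite ∧ M.IsStrong n m (M.cl0 n m X) ∧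
      ∀ Z : Set V, Z.Finite → X ⊆ Z → M.delta n m (M.cl0 n m X) ≤ M.delta n m Z := by
  classical
  have hex : ∃ k : ℕ, ∃ Z : Set V, Z.Finite ∧ X ⊆ Z ∧ (M.delta n m Z).toNat = k :=
    ⟨_, X, hX, subset_rfl, rfl⟩
  have hmin := fun Z (h1 : Set.Finite Z) (h2 : X ⊆ Z) => Nat.find_min' hex ⟨Z, h1, h2, rfl⟩
  have hex2 : ∃ c : ℕ, ∃ Z : Set V, Z.Finite ∧ X ⊆ Z ∧
      (M.delta n m Z).toNat = Nat.find hex ∧ Z.ncard = c := by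
    obtain ⟨Z, h1, h2, h3⟩ := Nat.find_spec hex
    exact ⟨_, Z, h1, h2, h3, rfl⟩
  obtain ⟨Y, hY, hXY, hY1, hY2⟩ := Nat.find_spec hex2
  have hle : ∀ Z : Set V, Z.Finite → X ⊆ Z → M.delta n m Y ≤ M.delta n m Z := by
    intro Z hZ hXZ
    have h1 := hmin Z hZ hXZ
    have h2 := hM Z hZ
    omega
  have hst : M.IsStrong n m Y :=
    M.isStrong_of_delta_le hY fun B hB hYB => hle B hB (hXY.trans hYB)
  have hcl : M.cl0 n m X = Y := by
    refine (cl0_subset hst hXY).antisymm ?_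
    refine Set.subset_sInter fun C hC => ?_
    have h1 : (Y ∩ C).Finite := hY.subset Set.inter_subset_left
    have h2 : X ⊆ Y ∩ C := Set.subset_inter hXY hC.1
    have h3 := hC.2.delta_inter_le hY
    have h4 := hle _ h1 h2
    have h5 := Nat.find_min' hex2 ⟨Y ∩ C, h1, h2, by rw [← hY1, le_antisymm h3 h4], rfl⟩
    rw [← hY2] at h5
    have h6 := Set.eq_of_subset_of_ncard_le (Set.inter_subset_left (s := Y) (t := C)) h5 hY
    exact Set.inter_eq_left.1 h6
  rw [hcl]
  exact ⟨hY, hst, hle⟩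

theorem cl0_eq_self {C : Set V} (hC : M.IsStrong n m C) : M.cl0 n m C = C :=
  (cl0_subset hC subset_rfl).antisymm (subset_cl0 C)

theorem dim_eq_delta {C : Set V} (hC : M.IsStrong n m C) : M.dim n m C = M.delta n m C := by
  rw [dim, cl0_eq_self hC]

theorem dim_le_delta (hM : M.MemC0 n m) {X Z : Set V} (hZ : Z.Finite) (h : X ⊆ Z) :
    M.dim n m X ≤ M.delta n m Z :=
  (cl0_spec hM (hZ.subset h)).2.2 Z hZ h

theorem dim_mono (hM : M.MemC0 n m) {X Y : Set V} (hY : Y.Finite) (h : X ⊆ Y) :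
    M.dim n m X ≤ M.dim n m Y :=
  dim_le_delta hM (cl0_spec hM hY).1 (h.trans (subset_cl0 Y))

theorem dim_cl0 (hM : M.MemC0 n m) {X : Set V} (hX : X.Finite) :
    M.dim n m (M.cl0 n m X) = M.dim n m X :=
  dim_eq_delta (cl0_spec hM hX).2.1

theorem dim_submodular (hM : M.MemC0 n m) {X Y : Set V} (hX : X.Finite) (hY : Y.Finite) :
    M.dim n m (X ∪ Y) + M.dim n m (X ∩ Y) ≤ M.dim n m X + M.dim n m Y := by
  have h1 := (cl0_spec hM hX).1
  have h2 := (cl0_spec hM hY).1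
  have h3 := M.delta_submodular (n := n) (m := m) h1 h2
  have h4 : M.dim n m (X ∪ Y) ≤ _ := dim_le_delta hM (h1.union h2)
    (Set.union_subset_union (subset_cl0 X) (subset_cl0 Y))
  have h5 : M.dim n m (X ∩ Y) ≤ M.delta n m (M.cl0 n m X ∩ M.cl0 n m Y) := dim_le_delta hM (h1.subset Set.inter_subset_left)
    (Set.inter_subset_inter (subset_cl0 X) (subset_cl0 Y))
  unfold dim at *
  linarith

/-- A finite set whose predimension is its dimension is strong. -/
theorem isStrong_of_delta_le_dim (hM : M.MemC0 n m) {X : Set V} (hX : X.Finite)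
    (h : M.delta n m X ≤ M.dim n m X) : M.IsStrong n m X :=
  M.isStrong_of_delta_le hX fun _ hB hXB => h.trans (dim_le_delta hM hB hXB)

end Predimension

/-! ### The dimension and its closure operator -/

section Closure

variable {r n m : ℕ} {V : Type*} {M : UniformHypergraph r V}

theorem mem_dcl_iff (hM : M.MemC0 n m) {Z : Set V} {a : V} :
    a ∈ M.dcl n m Z ↔
      ∃ Y : Set V, Y.Finite ∧ Y ⊆ Z ∧ M.dim n m ({a} ∪ Y) = M.dim n m Y := by
  set T := {k | ∃ Y : Set V, Y.Finite ∧ Y ⊆ Z ∧ k = M.dim n m ({a} ∪ Y) - M.dim n m Y} with hT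
  have hne : T.Nonempty := ⟨_, ∅, Set.finite_empty, Set.empty_subset _, rfl⟩
  have hnn : ∀ k ∈ T, 0 ≤ k := by
    rintro k ⟨Y, hY, -, rfl⟩
    have := dim_mono (n := n) (m := m) hM ((Set.finite_singleton a).union hY)
      (Set.subset_union_right (s := {a}) (t := Y))
    linarith
  have hbdd : BddBelow T := ⟨0, fun k hk => hnn k hk⟩
  have hdef : a ∈ M.dcl n m Z ↔ sInf T = 0 := Iff.rfl
  rw [hdef]
  constructor
  · intro h
    obtain ⟨Y, hY, hYZ, hk⟩ := Int.csInf_mem hne hbdd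
    exact ⟨Y, hY, hYZ, by linarith⟩
  · rintro ⟨Y, hY, hYZ, hk⟩
    refine le_antisymm (csInf_le hbdd ⟨Y, hY, hYZ, by linarith⟩) (le_csInf hne hnn)

theorem dcl_mono (hM : M.MemC0 n m) {Z W : Set V} (h : Z ⊆ W) : M.dcl n m Z ⊆ M.dcl n m W := by
  intro a ha
  obtain ⟨Y, hY, hYZ, hk⟩ := (mem_dcl_iff hM).1 ha
  exact (mem_dcl_iff hM).2 ⟨Y, hY, hYZ.trans h, hk⟩

theorem subset_dcl (hM : M.MemC0 n m) (Z : Set V) : Z ⊆ M.dcl n m Z := by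
  intro a ha
  exact (mem_dcl_iff hM).2 ⟨{a}, Set.finite_singleton a, by simpa using ha, by simp⟩

/-- Relative dimension is nonnegative and, by submodularity, decreases as the base grows. -/
theorem dim_union_eq_of_subset (hM : M.MemC0 n m) {X Y Z : Set V} (hX : X.Finite) (hZ : Z.Finite)
    (hYZ : Y ⊆ Z) (h : M.dim n m (X ∪ Y) = M.dim n m Y) :
    M.dim n m (X ∪ Z) = M.dim n m Z := by
  have hY := hZ.subset hYZ
  refine le_antisymm ?_ (dim_mono hM (hX.union hZ) Set.subset_union_right)
  have h1 := dim_submodular (n := n) (m := m) hM (hX.union hY) hZ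
  rw [Set.union_assoc, Set.union_eq_right.2 hYZ] at h1
  have h2 : M.dim n m Y ≤ M.dim n m ((X ∪ Y) ∩ Z) :=
    dim_mono hM (hZ.subset Set.inter_subset_right) (Set.subset_inter Set.subset_union_right hYZ)
  linarith

theorem exists_finite_dim_union_eq (hM : M.MemC0 n m) {X Z : Set V} (hX : X.Finite)
    (h : X ⊆ M.dcl n m Z) :
    ∃ Y : Set V, Y.Finite ∧ Y ⊆ Z ∧ M.dim n m (X ∪ Y) = M.dim n m Y := by
  induction X, hX using Set.Finite.induction_on with
  | empty => exact ⟨∅, Set.finite_empty, Set.empty_subset _, by simp⟩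
  | @insert a X _ hX ih =>
    obtain ⟨Y, hY, hYZ, hk⟩ := ih ((Set.subset_insert a X).trans h)
    obtain ⟨Y', hY', hYZ', hk'⟩ := (mem_dcl_iff hM).1 (h (Set.mem_insert a X))
    refine ⟨Y ∪ Y', hY.union hY', Set.union_subset hYZ hYZ', ?_⟩
    have h1 := dim_union_eq_of_subset hM (Set.finite_singleton a) (hX.union (hY.union hY'))
      (Set.subset_union_right.trans Set.subset_union_right) hk'
    have h2 := dim_union_eq_of_subset hM hX (hY.union hY') (Set.subset_union_left (t := Y')) hk
    rw [Set.insert_eq, Set.union_assoc, h1, h2]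

theorem dim_union_eq_of_subset_dcl (hM : M.MemC0 n m) {X Y : Set V} (hX : X.Finite)
    (hY : Y.Finite) (h : X ⊆ M.dcl n m Y) : M.dim n m (X ∪ Y) = M.dim n m Y := by
  obtain ⟨Y', -, hYY, hk⟩ := exists_finite_dim_union_eq hM hX h
  exact dim_union_eq_of_subset hM hX hY hYY hk

theorem dcl_dcl (hM : M.MemC0 n m) (Z : Set V) : M.dcl n m (M.dcl n m Z) ⊆ M.dcl n m Z := by
  intro a ha
  obtain ⟨X, hX, hXZ, hk⟩ := (mem_dcl_iff hM).1 ha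
  obtain ⟨Y, hY, hYZ, hk'⟩ := exists_finite_dim_union_eq hM hX hXZ
  refine (mem_dcl_iff hM).2 ⟨Y, hY, hYZ, ?_⟩
  refine le_antisymm ?_ (dim_mono hM ((Set.finite_singleton a).union hY) Set.subset_union_right)
  have h1 := dim_union_eq_of_subset hM (Set.finite_singleton a) (hX.union hY)
    (Set.subset_union_left (t := Y)) hk
  calc M.dim n m ({a} ∪ Y) ≤ M.dim n m ({a} ∪ (X ∪ Y)) :=
        dim_mono hM ((Set.finite_singleton a).union (hX.union hY))
          (Set.union_subset_union_right _ Set.subset_union_right)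
    _ = M.dim n m Y := by rw [h1, hk']

theorem dcl_subset_dcl (hM : M.MemC0 n m) {Z W : Set V} (h : Z ⊆ M.dcl n m W) :
    M.dcl n m Z ⊆ M.dcl n m W :=
  (dcl_mono hM h).trans (dcl_dcl hM W)

theorem mem_dcl_of_dim_le (hM : M.MemC0 n m) {Y : Set V} (hY : Y.Finite) {a : V}
    (h : M.dim n m ({a} ∪ Y) ≤ M.dim n m Y) : a ∈ M.dcl n m Y :=
  (mem_dcl_iff hM).2 ⟨Y, hY, subset_rfl, h.antisymm
    (dim_mono hM ((Set.finite_singleton a).union hY) Set.subset_union_right)⟩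

theorem cl0_subset_dcl (hM : M.MemC0 n m) {X : Set V} (hX : X.Finite) :
    M.cl0 n m X ⊆ M.dcl n m X := by
  intro a ha
  have h := (cl0_spec (n := n) (m := m) hM hX).1
  refine mem_dcl_of_dim_le hM hX ?_
  rw [← dim_cl0 hM hX]
  exact dim_mono hM h (Set.union_subset (by simpa using ha) (subset_cl0 X))

/-- Closing under `cl0` adds only dependent points, so it leaves neither `E` nor the `d`-closed set.
-/
theorem isStrong_inter_dcl (hM : M.MemC0 n m) {E Z : Set V} (hE : E.Finite)
    (hs : M.IsStrong n m E) : M.IsStrong n m (E ∩ M.dcl n m Z) := by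
  have hf := hE.subset (Set.inter_subset_left (t := M.dcl n m Z))
  have h : M.cl0 n m (E ∩ M.dcl n m Z) = E ∩ M.dcl n m Z := by
    refine Set.Subset.antisymm (Set.subset_inter (cl0_subset hs Set.inter_subset_left) ?_)
      (subset_cl0 _)
    exact (cl0_subset_dcl hM hf).trans (dcl_subset_dcl hM Set.inter_subset_right)
  rw [← h]
  exact (cl0_spec hM hf).2.1

end Closure

/-! ### Finite partial isomorphisms and genericity -/

section PartialIso

variable {r n m : ℕ} {V : Type*}

/-- The permutation `σ` restricts to an embedding of `H`, restricted to `S`, into `H'`. -/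
def IsoOn (H H' : UniformHypergraph r V) (σ : Equiv.Perm V) (S : Set V) : Prop :=
  ∀ e : Finset V, ↑e ⊆ S → (e.map σ.toEmbedding ∈ H'.edges ↔ e ∈ H.edges)

theorem delta_image {W : Type*} {K : UniformHypergraph r W} {H : UniformHypergraph r V}
    (f : W ↪ V) {B : Set W} (h : ∀ e : Finset W, ↑e ⊆ B → (e.map f ∈ H.edges ↔ e ∈ K.edges)) :
    H.delta n m (f '' B) = K.delta n m B := by
  have h1 : H.edgesIn (f '' B) = Finset.map f '' K.edgesIn B := by
    ext e
    constructor
    · rintro ⟨he, heB⟩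
      refine ⟨e.preimage f f.injective.injOn, ⟨?_, ?_⟩, ?_⟩
      all_goals
        have h2 : (e.preimage f f.injective.injOn).map f = e := by
          ext x
          simp only [Finset.mem_map, Finset.mem_preimage]
          constructor
          · rintro ⟨a, ha, rfl⟩
            exact ha
          · intro hx
            obtain ⟨a, -, rfl⟩ := heB hx
            exact ⟨a, hx, rfl⟩
        have h3 : (↑(e.preimage f f.injective.injOn) : Set W) ⊆ B := by
          intro a ha
          obtain ⟨b, hb, hab⟩ := heB (Finset.mem_preimage.1 ha)
          rwa [← f.injective hab]
      · rw [← h _ h3, h2]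
        exact he
      · exact h3
      · exact h2
    · rintro ⟨e, ⟨he, heB⟩, rfl⟩
      refine ⟨(h e heB).2 he, ?_⟩
      rw [Finset.coe_map]
      exact Set.image_mono heB
  unfold delta
  rw [h1, Set.ncard_image_of_injective _ f.injective,
    Set.ncard_image_of_injective _ (Finset.map_injective f)]

variable {H H' : UniformHypergraph r V} {σ : Equiv.Perm V} {S : Set V}

theorem IsoOn.delta_image (h : IsoOn H H' σ S) {B : Set V} (hB : B ⊆ S) :
    H'.delta n m (σ '' B) = H.delta n m B :=
  UniformHypergraph.delta_image (r := r) σ.toEmbedding fun e he => h e (he.trans hB)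

theorem IsoOn.symm (h : IsoOn H H' σ S) : IsoOn H' H σ.symm (σ '' S) := by
  intro e he
  have h1 : (e.map σ.symm.toEmbedding).map σ.toEmbedding = e := by
    ext x
    simp
  rw [← h, h1]
  rw [Finset.coe_map]
  rintro _ ⟨x, hx, rfl⟩
  obtain ⟨y, hy, rfl⟩ := he hx
  simpa using hy

theorem IsoOn.isStrong_image {M : UniformHypergraph r V} {Q C : Set V} (h : IsoOn H M σ Q)
    (hQ : Q.Finite) (hs : M.IsStrong n m (σ '' Q)) (hCQ : C ⊆ Q)
    (hC : ∀ B : Set V, C ⊆ B → B ⊆ Q → H.delta n m C ≤ H.delta n m B) :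
    M.IsStrong n m (σ '' C) := by
  refine M.isStrong_of_delta_le ((hQ.subset hCQ).image σ) fun B hB hCB => ?_
  refine le_trans ?_ (hs.delta_inter_le hB)
  obtain ⟨B', hB', h1⟩ := Set.subset_image_iff.1 (Set.inter_subset_right (s := B) (t := σ '' Q))
  have h2 : σ '' C ⊆ σ '' B' := by
    rw [h1]
    exact Set.subset_inter hCB (Set.image_mono hCQ)
  rw [← h1, h.delta_image hB', h.delta_image hCQ]
  exact hC B' ((Set.image_subset_image_iff σ.injective).1 h2) hB'

/-- Finite partial maps are represented throughout by permutations of `V`, so that images, inverses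
and composites need no subtypes. -/
theorem exists_perm_extending {ι : Type*} [Finite ι] (f g : ι ↪ V) :
    ∃ σ : Equiv.Perm V, ∀ i, σ (f i) = g i := by
  obtain ⟨k, ⟨e⟩⟩ := Finite.exists_equiv_fin ι
  have := Equiv.Perm.isMultiplyPretransitive V k
  obtain ⟨σ, hσ⟩ := MulAction.exists_smul_eq (Equiv.Perm V)
    (e.symm.toEmbedding.trans f) (e.symm.toEmbedding.trans g)
  refine ⟨σ, fun i => ?_⟩
  have := DFunLike.congr_fun hσ (e i)
  simpa using this

/-- Extension property of the generic structure, for partial isomorphisms given by permutations. -/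
theorem IsGeneric.exists_extension {M : UniformHypergraph r V} (hM : M.IsGeneric n m)
    {X Q : Set V} {g : Equiv.Perm V} (hQ : Q.Finite) (hXQ : X ⊆ Q) (hg : IsoOn H M g X)
    (hgX : M.IsStrong n m (g '' X))
    (hX : ∀ B : Set V, X ⊆ B → B ⊆ Q → H.delta n m X ≤ H.delta n m B) :
    ∃ σ : Equiv.Perm V, (∀ x ∈ X, σ x = g x) ∧ IsoOn H M σ Q ∧ M.IsStrong n m (σ '' Q) := by
  have hXf := hQ.subset hXQ
  have : Finite Q := hQ
  -- `Q` is transported to `Fin N` because the extension property quantifies over `Type`, while `V`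
  -- may lie in any universe.
  obtain ⟨N, ⟨eq⟩⟩ := Finite.exists_equiv_fin Q
  let ι : Fin N ↪ V := eq.symm.toEmbedding.trans (Function.Embedding.subtype _)
  have hιQ : Set.range ι = Q := by
    ext x
    constructor
    · rintro ⟨i, rfl⟩
      exact (eq.symm i).2
    · intro hx
      exact ⟨eq ⟨x, hx⟩, by simp [ι]⟩
  have hδ : ∀ S : Set (Fin N), (H.comap ι).delta n m S = H.delta n m (ι '' S) := fun S =>
    (UniformHypergraph.delta_image ι fun e _ => Iff.rfl).symm
  have hιS : ∀ S : Set (Fin N), ι '' S ⊆ Q := fun S => hιQ ▸ Set.image_subset_range ι S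
  -- `δ(T) ≥ δ(T ∩ X) + δ(T ∪ X) - δ(X) ≥ δ(T ∩ X)`, and the last set is copied into `M` by `g`.
  have hmem : (H.comap ι).MemC0 n m := by
    intro S _
    rw [hδ]
    set T := ι '' S
    have hT := hιS S
    have h1 := H.delta_submodular (n := n) (m := m) (hQ.subset hT) hXf
    have h2 := hX (T ∪ X) Set.subset_union_right (Set.union_subset hT hXQ)
    have h3 := hM.memC0 (g '' (T ∩ X)) ((hXf.subset Set.inter_subset_right).image g)
    rw [hg.delta_image Set.inter_subset_right] at h3
    linarith
  have hpre : ∀ y ∈ g '' X, g.symm y ∈ X := by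
    rintro _ ⟨x, hx, rfl⟩
    simpa using hx
  let j : ↥(g '' X) ↪ Fin N :=
    ⟨fun y => eq ⟨g.symm y, hXQ (hpre y y.2)⟩, fun y z h => by
      have := congrArg Subtype.val (eq.injective h)
      exact Subtype.ext (g.symm.injective this)⟩
  have hιj : ∀ y, ι (j y) = g.symm y := fun y => by
    change ((eq.symm (eq _) : Q) : V) = _
    rw [Equiv.symm_apply_apply]
  have hjX : ι '' Set.range j = X := by
    ext x
    constructor
    · rintro ⟨_, ⟨y, rfl⟩, rfl⟩
      rw [hιj]
      exact hpre y y.2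
    · intro hx
      refine ⟨_, ⟨⟨g x, x, hx, rfl⟩, rfl⟩, ?_⟩
      rw [hιj]
      simp
  have hcomap : (H.comap ι).comap j = M.comap (Function.Embedding.subtype (· ∈ g '' X)) := by
    suffices h : ∀ e : Finset ↥(g '' X), (e.map j).map ι ∈ H.edges ↔
        e.map (Function.Embedding.subtype (· ∈ g '' X)) ∈ M.edges by
      have : ((H.comap ι).comap j).edges =
          (M.comap (Function.Embedding.subtype (· ∈ g '' X))).edges := Set.ext h
      cases h1 : (H.comap ι).comap j
      cases h2 : M.comap (Function.Embedding.subtype (· ∈ g '' X))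
      rw [h1, h2] at this
      subst this
      rfl
    intro e
    rw [← hg]
    · have : ((e.map j).map ι).map g.toEmbedding =
          e.map (Function.Embedding.subtype (· ∈ g '' X)) := by
        rw [Finset.map_map, Finset.map_map]
        congr 1
        ext y
        simp [hιj]
      rw [this]
    · rw [Finset.coe_map, Finset.coe_map]
      exact (Set.image_mono (Set.image_subset_range _ _)).trans hjX.le
  have hstr : (H.comap ι).IsStrong n m (Set.range j) := by
    refine isStrong_of_delta_le _ (Set.toFinite _) fun B _ hB => ?_
    rw [hδ, hδ, hjX]
    refine hX _ ?_ (hιS B)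
    rw [← hjX]
    exact Set.image_mono hB
  obtain ⟨α, hα, hαj, hαs⟩ := hM.extension (g '' X) (hXf.image g) hgX (Fin N) (H.comap ι) hmem j
    hcomap hstr
  obtain ⟨σ, hσ⟩ := exists_perm_extending ι α
  refine ⟨σ, fun x hx => ?_, fun e he => ?_, ?_⟩
  · have h1 := hσ (j ⟨g x, x, hx, rfl⟩)
    rw [hιj, hαj] at h1
    simpa using h1
  · obtain ⟨e, rfl⟩ : ∃ e' : Finset (Fin N), e'.map ι = e := by
      refine ⟨e.preimage ι ι.injective.injOn, ?_⟩
      ext x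
      simp only [Finset.mem_map, Finset.mem_preimage]
      constructor
      · rintro ⟨a, ha, rfl⟩
        exact ha
      · intro hx
        have := he hx
        rw [← hιQ] at this
        obtain ⟨a, rfl⟩ := this
        exact ⟨a, hx, rfl⟩
    have h1 : (e.map ι).map σ.toEmbedding = e.map α := by
      rw [Finset.map_map]
      congr 1
      ext i
      simp [hσ]
    rw [h1]
    change e ∈ (M.comap α).edges ↔ e ∈ (H.comap ι).edges
    rw [hα]
  · convert hαs
    rw [← hιQ, ← Set.range_comp]
    congr 1
    ext i
    exact hσ i

end PartialIso

/-! ### Invariance under automorphisms -/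

section Automorphism

variable {r n m : ℕ} {V : Type*} {M : UniformHypergraph r V} {g : Equiv.Perm V}

theorem isAut_iff : M.IsAut g ↔ IsoOn M M g Set.univ := by
  constructor
  · intro h e _
    change e ∈ (M.comap g.toEmbedding).edges ↔ _
    rw [h]
  · intro h
    have h1 : (M.comap g.toEmbedding).edges = M.edges := Set.ext fun e => h e (Set.subset_univ _)
    unfold IsAut
    cases M
    cases h2 : comap _ _
    rw [h2] at h1
    subst h1
    rfl

theorem IsAut.symm (h : M.IsAut g) : M.IsAut g.symm := by
  have := (isAut_iff.1 h).symm
  rw [Set.image_univ_of_surjective g.surjective] at this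
  exact isAut_iff.2 this

theorem IsAut.trans {g' : Equiv.Perm V} (h : M.IsAut g) (h' : M.IsAut g') :
    M.IsAut (g.trans g') := by
  rw [isAut_iff] at *
  intro e _
  have h1 := h' (e.map g.toEmbedding) (Set.subset_univ _)
  rw [h e (Set.subset_univ _), Finset.map_map] at h1
  exact h1

theorem IsAut.delta_image (h : M.IsAut g) (X : Set V) : M.delta n m (g '' X) = M.delta n m X :=
  (isAut_iff.1 h).delta_image (Set.subset_univ X)

theorem IsAut.isStrong_image (h : M.IsAut g) {C : Set V} (hC : M.IsStrong n m C) :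
    M.IsStrong n m (g '' C) := by
  intro X hX B h1 h2
  have h3 : g.symm '' (X ∩ g '' C) = g.symm '' X ∩ C := by
    rw [Set.image_inter g.symm.injective, Equiv.symm_image_image]
  rw [← h.symm.delta_image, ← h.symm.delta_image B, h3]
  refine hC _ (hX.image _) _ ?_ (Set.image_mono h2)
  rw [← h3]
  exact Set.image_mono h1

theorem IsAut.cl0_image (h : M.IsAut g) (hM : M.MemC0 n m) {X : Set V} (hX : X.Finite) :
    M.cl0 n m (g '' X) = g '' M.cl0 n m X := by
  refine (cl0_subset (h.isStrong_image (cl0_spec hM hX).2.1)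
    (Set.image_mono (subset_cl0 X))).antisymm ?_
  have h1 := cl0_subset (h.symm.isStrong_image (cl0_spec (n := n) (m := m) hM (hX.image g)).2.1)
    (X := X) (by
      conv_lhs => rw [← Equiv.symm_image_image g X]
      exact Set.image_mono (subset_cl0 _))
  have h2 := Set.image_mono (f := g) h1
  rwa [Equiv.image_symm_image] at h2

theorem IsAut.dim_image (h : M.IsAut g) (hM : M.MemC0 n m) {X : Set V} (hX : X.Finite) :
    M.dim n m (g '' X) = M.dim n m X := by
  unfold dim
  rw [h.cl0_image hM hX, h.delta_image]

theorem IsAut.mem_dcl (h : M.IsAut g) (hM : M.MemC0 n m) {Z : Set V} {a : V}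
    (ha : a ∈ M.dcl n m Z) : g a ∈ M.dcl n m (g '' Z) := by
  obtain ⟨Y, hY, hYZ, hk⟩ := (mem_dcl_iff hM).1 ha
  refine (mem_dcl_iff hM).2 ⟨g '' Y, hY.image g, Set.image_mono hYZ, ?_⟩
  rw [← Set.image_singleton, ← Set.image_union, h.dim_image hM hY,
    h.dim_image hM ((Set.finite_singleton a).union hY), hk]

theorem mem_orb_self (A : Set V) (b : V) : b ∈ M.orb A b :=
  ⟨1, isAut_iff.2 fun e _ => by simp [Equiv.Perm.one_def], fun _ _ => rfl, rfl⟩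

end Automorphism

/-! ### Back-and-forth over an infinite closed set -/

section Orbit

variable {r n m : ℕ} {V : Type*} {M : UniformHypergraph r V}

/-- A finite strong set is free from the `d`-closure of any of its subsets. -/
theorem isStrong_union_of_subset_dcl (hM : M.MemC0 n m) (hm : 1 ≤ m) {A₁ E A₂ : Set V}
    (hE : E.Finite) (hEs : M.IsStrong n m E) (hA₁ : A₁ ⊆ E) (hA₂ : A₂.Finite)
    (hA₂s : M.IsStrong n m A₂) (hA₂c : A₂ ⊆ M.dcl n m A₁) (hEA : E ∩ M.dcl n m A₁ ⊆ A₂) :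
    M.IsStrong n m (E ∪ A₂) ∧ M.edgesIn (E ∪ A₂) ⊆ M.edgesIn E ∪ M.edgesIn A₂ := by
  have hA₁f := hE.subset hA₁
  have h1 : M.dim n m (E ∪ A₂) = M.delta n m E := by
    rw [Set.union_comm, ← dim_eq_delta hEs]
    exact dim_union_eq_of_subset_dcl hM hA₂ hE (hA₂c.trans (dcl_mono hM hA₁))
  have h12 : A₁ ⊆ E ∩ A₂ := fun x hx => ⟨hA₁ hx, hEA ⟨hA₁ hx, subset_dcl hM _ hx⟩⟩
  have h2 : M.delta n m A₂ ≤ M.delta n m (E ∩ A₂) := by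
    rw [← dim_eq_delta hA₂s, ← dim_eq_delta (hEs.inter hA₂s)]
    have h3 := dim_union_eq_of_subset_dcl hM hA₂ hA₁f hA₂c
    rw [Set.union_eq_left.2 (h12.trans Set.inter_subset_right)] at h3
    rw [h3]
    exact dim_mono hM (hE.subset Set.inter_subset_left) h12
  -- Since `δ(A₂) ≤ δ(E ∩ A₂)`, this gives `δ(E ∪ A₂) ≤ δ(E) = d(E ∪ A₂)`: the union is strong, and
  -- equality in submodularity excludes hyperedges across.
  have h4 := M.delta_submodular (n := n) (m := m) hE hA₂
  have h5 : M.dim n m (E ∪ A₂) ≤ _ := dim_le_delta hM (hE.union hA₂) subset_rfl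
  exact ⟨isStrong_of_delta_le_dim hM (hE.union hA₂) (by linarith),
    M.edgesIn_union_of_delta_le hm hE hA₂ (by linarith)⟩

variable (n m M) in
/-- A finite partial isomorphism between strong sets that fixes the `d`-closure of `A₁`. -/
structure PartialAut (A₁ : Set V) where
  dom : Set V
  perm : Equiv.Perm V
  finite : dom.Finite
  subset_dom : A₁ ⊆ dom
  isStrong : M.IsStrong n m dom
  isStrong_image : M.IsStrong n m (perm '' dom)
  isoOn : IsoOn M M perm dom
  fix : ∀ x ∈ dom, x ∈ M.dcl n m A₁ → perm x = x

namespace PartialAut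

variable {A₁ : Set V}

instance : Preorder (PartialAut n m M A₁) where
  le p q := p.dom ⊆ q.dom ∧ ∀ x ∈ p.dom, q.perm x = p.perm x
  le_refl _ := ⟨subset_rfl, fun _ _ => rfl⟩
  le_trans _ _ _ h h' :=
    ⟨h.1.trans h'.1, fun x hx => (h'.2 x (h.1 hx)).trans (h.2 x hx)⟩

/-- The set computing the dimension of the image point over `A₁` lies inside the strong image of
`p`, so it pulls back with the same `δ`. This makes the inverse of `p` fix the closure as well. -/
theorem mem_dcl_of_perm_mem (hM : M.MemC0 n m) (p : PartialAut n m M A₁) {x : V}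
    (hx : x ∈ p.dom) (h : p.perm x ∈ M.dcl n m A₁) : x ∈ M.dcl n m A₁ := by
  have hA₁ := p.finite.subset p.subset_dom
  have hf := (Set.finite_singleton (p.perm x)).union hA₁
  have h1 := dim_union_eq_of_subset_dcl hM (Set.finite_singleton (p.perm x)) hA₁ (by simpa using h)
  have hA : ∀ a ∈ A₁, p.perm a = a := fun a ha => p.fix a (p.subset_dom ha) (subset_dcl hM _ ha)
  have h2 : M.cl0 n m ({p.perm x} ∪ A₁) ⊆ p.perm '' p.dom := by
    refine cl0_subset p.isStrong_image (Set.union_subset ?_ fun a ha => ?_)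
    · simpa using hx
    · exact ⟨a, p.subset_dom ha, hA a ha⟩
  obtain ⟨B, hB, hBc⟩ := Set.subset_image_iff.1 h2
  have h3 : {x} ∪ A₁ ⊆ B := by
    rw [← Set.image_subset_image_iff p.perm.injective, hBc, Set.image_union, Set.image_singleton,
      Set.image_congr (fun a ha => hA a ha), Set.image_id']
    exact subset_cl0 _
  refine mem_dcl_of_dim_le hM hA₁ ?_
  rw [← h1]
  refine (dim_le_delta hM (p.finite.subset hB) h3).trans ?_
  rw [← p.isoOn.delta_image hB, hBc]
  rfl

/-- The inverse partial automorphism. -/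
def symm (hM : M.MemC0 n m) (p : PartialAut n m M A₁) : PartialAut n m M A₁ where
  dom := p.perm '' p.dom
  perm := p.perm.symm
  finite := p.finite.image _
  subset_dom := fun a ha => ⟨a, p.subset_dom ha, p.fix a (p.subset_dom ha) (subset_dcl hM _ ha)⟩
  isStrong := p.isStrong_image
  isStrong_image := by
    rw [Equiv.symm_image_image]
    exact p.isStrong
  isoOn := p.isoOn.symm
  fix := by
    rintro _ ⟨x, hx, rfl⟩ h
    rw [Equiv.symm_apply_apply]
    exact (p.fix x hx (p.mem_dcl_of_perm_mem hM hx h)).symm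

/-- The extension must fix the infinite set `dcl A₁`, but only its trace `A₂` on `E₂ = cl0(dom ∪
{c})` matters. Since `dom` and its image are both free from `A₂`, `p` glued with the identity on
`A₂` is an isomorphism of strong sets, and genericity extends it to `E₂`. -/
theorem exists_le_mem_dom (hM : M.IsGeneric n m) (hm : 1 ≤ m) (p : PartialAut n m M A₁) (c : V) :
    ∃ q : PartialAut n m M A₁, p ≤ q ∧ c ∈ q.dom := by
  classical
  have hC := hM.memC0
  have hf : (p.dom ∪ {c}).Finite := p.finite.union (Set.finite_singleton c)
  obtain ⟨hE₂, hE₂s, -⟩ := cl0_spec (n := n) (m := m) hC hf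
  set E₂ := M.cl0 n m (p.dom ∪ {c}) with hE₂def
  have hsub : p.dom ∪ {c} ⊆ E₂ := subset_cl0 _
  have hEE₂ : p.dom ⊆ E₂ := Set.subset_union_left.trans hsub
  set A₂ := E₂ ∩ M.dcl n m A₁ with hA₂def
  have hA₂s : M.IsStrong n m A₂ := isStrong_inter_dcl hC hE₂ hE₂s
  have hA₂f : A₂.Finite := hE₂.subset Set.inter_subset_left
  have hfix : ∀ x ∈ p.dom, p.perm x ∈ M.dcl n m A₁ → p.perm x = x :=
    fun x hx h => p.fix x hx (p.mem_dcl_of_perm_mem hC hx h)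
  obtain ⟨hXs, hXe⟩ := isStrong_union_of_subset_dcl hC hm p.finite p.isStrong p.subset_dom hA₂f
    hA₂s Set.inter_subset_right (Set.inter_subset_inter_left _ hEE₂)
  obtain ⟨hYs, hYe⟩ := isStrong_union_of_subset_dcl hC hm (A₁ := A₁) (p.finite.image p.perm)
    p.isStrong_image (p.symm hC).subset_dom hA₂f hA₂s Set.inter_subset_right (by
      rintro _ ⟨⟨x, hx, rfl⟩, h⟩
      refine ⟨?_, h⟩
      rw [hfix x hx h]
      exact hEE₂ hx)
  have hXf : (p.dom ∪ A₂).Finite := p.finite.union hA₂f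
  have : Finite ↥(p.dom ∪ A₂) := hXf
  -- Values of the two pieces can coincide only in `dcl A₁`, where `hfix` says that `p` is the
  -- identity.
  obtain ⟨g, hg⟩ := exists_perm_extending (Function.Embedding.subtype (· ∈ p.dom ∪ A₂))
    ⟨fun x => if (x : V) ∈ p.dom then p.perm x else x, by
      rintro ⟨x, hx⟩ ⟨y, hy⟩ h
      apply Subtype.ext
      simp only at h ⊢
      split_ifs at h with h1 h2 h2
      · exact p.perm.injective h
      · have h3 : p.perm x ∈ M.dcl n m A₁ := by
          rw [h]
          exact (hy.resolve_left h2).2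
        rw [← h, hfix x h1 h3]
      · have h3 : p.perm y ∈ M.dcl n m A₁ := by
          rw [← h]
          exact (hx.resolve_left h1).2
        rw [h, hfix y h2 h3]
      · exact h⟩
  have hg1 : ∀ x ∈ p.dom, g x = p.perm x := by
    intro x hx
    have : g x = if x ∈ p.dom then p.perm x else x := hg ⟨x, Or.inl hx⟩
    simpa [hx] using this
  have hg2 : ∀ x ∈ A₂, g x = x := by
    intro x hx
    have : g x = if x ∈ p.dom then p.perm x else x := hg ⟨x, Or.inr hx⟩
    by_cases h : x ∈ p.dom
    · rw [hg1 x h, p.fix x h hx.2]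
    · simpa [h] using this
  have hmapE : ∀ e : Finset V, ↑e ⊆ p.dom → e.map g.toEmbedding = e.map p.perm.toEmbedding := by
    intro e he
    rw [Finset.map_eq_image, Finset.map_eq_image]
    exact Finset.image_congr fun x hx => hg1 x (he hx)
  have hmapA : ∀ e : Finset V, (∀ x ∈ e, g x = x) → e.map g.toEmbedding = e := by
    intro e he
    rw [Finset.map_eq_image]
    conv_rhs => rw [← Finset.image_id (s := e)]
    exact Finset.image_congr fun x hx => he x hx
  have hgim : g '' (p.dom ∪ A₂) = p.perm '' p.dom ∪ A₂ := by
    rw [Set.image_union, Set.image_congr hg1, Set.image_congr hg2, Set.image_id']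
  have hiso : IsoOn M M g (p.dom ∪ A₂) := by
    intro e he
    constructor
    · intro h
      have h1 : ↑(e.map g.toEmbedding) ⊆ p.perm '' p.dom ∪ A₂ := by
        rw [← hgim, Finset.coe_map]
        exact Set.image_mono he
      rcases hYe ⟨h, h1⟩ with ⟨-, h2⟩ | ⟨-, h2⟩
      · have h3 : ↑e ⊆ p.dom := by
          intro x hx
          rcases he hx with h4 | h4
          · exact h4
          · obtain ⟨y, hy, hyx⟩ := h2 (Finset.mem_coe.2 (Finset.mem_map_of_mem _ hx))
            change p.perm y = g x at hyx
            rw [hg2 x h4] at hyx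
            have h5 := hfix y hy (hyx ▸ h4.2)
            rw [← hyx, h5]
            exact hy
        rw [hmapE e h3] at h
        exact (p.isoOn e h3).1 h
      · rwa [hmapA] at h
        intro x hx
        rcases he hx with h4 | h4
        · have h5 : g x ∈ A₂ := h2 (Finset.mem_coe.2 (Finset.mem_map_of_mem _ hx))
          rw [hg1 x h4] at h5 ⊢
          exact hfix x h4 h5.2
        · exact hg2 x h4
    · intro h
      rcases hXe ⟨h, he⟩ with ⟨-, h2⟩ | ⟨-, h2⟩
      · rw [hmapE e h2]
        exact (p.isoOn e h2).2 h
      · rwa [hmapA]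
        exact fun x hx => hg2 x (h2 hx)
  obtain ⟨τ, hτ, hτi, hτs⟩ := hM.exists_extension hE₂
    (Set.union_subset hEE₂ Set.inter_subset_left) hiso (hgim ▸ hYs)
    (fun B hB hBE => hXs.delta_le (hE₂.subset hBE) hB)
  refine ⟨⟨E₂, τ, hE₂, p.subset_dom.trans hEE₂, hE₂s, hτs, hτi, fun x hx hxA => ?_⟩,
    ⟨hEE₂, fun x hx => ?_⟩, hsub (Or.inr rfl)⟩
  · rw [hτ x (Or.inr ⟨hx, hxA⟩), hg2 x ⟨hx, hxA⟩]
  · change τ x = _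
    rw [hτ x (Or.inl hx), hg1 x hx]

theorem exists_le_mem_image (hM : M.IsGeneric n m) (hm : 1 ≤ m) (p : PartialAut n m M A₁)
    (c : V) : ∃ q : PartialAut n m M A₁, p ≤ q ∧ c ∈ q.perm '' q.dom := by
  obtain ⟨q, hpq, hc⟩ := exists_le_mem_dom hM hm (p.symm hM.memC0) c
  refine ⟨q.symm hM.memC0, ⟨fun x hx => ?_, fun x hx => ?_⟩, ?_⟩
  · have h1 := hpq.1 ⟨x, hx, rfl⟩
    have h2 : q.perm (p.perm x) = p.perm.symm (p.perm x) := hpq.2 _ ⟨x, hx, rfl⟩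
    rw [Equiv.symm_apply_apply] at h2
    exact ⟨_, h1, h2⟩
  · have h2 : q.perm (p.perm x) = p.perm.symm (p.perm x) := hpq.2 _ ⟨x, hx, rfl⟩
    rw [Equiv.symm_apply_apply] at h2
    change q.perm.symm x = p.perm x
    rw [Equiv.symm_apply_eq, h2]
  · change c ∈ q.perm.symm '' (q.perm '' q.dom)
    rwa [Equiv.symm_image_image]

/-- Countability gives an ideal of partial automorphisms meeting every cofinal set "`c` is in the
domain" and "`c` is in the image"; its union is the automorphism. -/
theorem exists_isAut (hM : M.IsGeneric n m) (hm : 1 ≤ m) (p : PartialAut n m M A₁) :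
    ∃ g : Equiv.Perm V, M.IsAut g ∧ (∀ a ∈ M.dcl n m A₁, g a = a) ∧
      ∀ x ∈ p.dom, g x = p.perm x := by
  classical
  have := hM.countable
  let _ : Encodable (V ⊕ V) := Encodable.ofCountable _
  let 𝒟 : V ⊕ V → Order.Cofinal (PartialAut n m M A₁) := Sum.elim
    (fun c => ⟨{q | c ∈ q.dom}, fun p => by
      obtain ⟨q, h1, h2⟩ := exists_le_mem_dom hM hm p c
      exact ⟨q, h2, h1⟩⟩)
    (fun c => ⟨{q | c ∈ q.perm '' q.dom}, fun p => by
      obtain ⟨q, h1, h2⟩ := exists_le_mem_image hM hm p c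
      exact ⟨q, h2, h1⟩⟩)
  let I := Order.idealOfCofinals p 𝒟
  have hdom : ∀ c, ∃ q ∈ I, c ∈ q.dom := fun c => by
    obtain ⟨q, h1, h2⟩ := Order.cofinal_meets_idealOfCofinals p 𝒟 (Sum.inl c)
    exact ⟨q, h2, h1⟩
  have him : ∀ c, ∃ q ∈ I, c ∈ q.perm '' q.dom := fun c => by
    obtain ⟨q, h1, h2⟩ := Order.cofinal_meets_idealOfCofinals p 𝒟 (Sum.inr c)
    exact ⟨q, h2, h1⟩
  choose q hqI hq using hdom
  let F : V → V := fun v => (q v).perm v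
  have hF : ∀ p' ∈ I, ∀ v ∈ p'.dom, F v = p'.perm v := by
    intro p' hp' v hv
    obtain ⟨t, ht, h1, h2⟩ := I.directed p' hp' (q v) (hqI v)
    exact (h2.2 v (hq v)).symm.trans (h1.2 v hv)
  have hcover : ∀ e : Finset V, ∃ t ∈ I, ↑e ⊆ t.dom := by
    intro e
    induction e using Finset.induction_on with
    | empty => exact ⟨p, Order.mem_idealOfCofinals p 𝒟, by simp⟩
    | insert a e _ ih =>
      obtain ⟨t, ht, hte⟩ := ih
      obtain ⟨t', ht', h1, h2⟩ := I.directed t ht (q a) (hqI a)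
      refine ⟨t', ht', ?_⟩
      rw [Finset.coe_insert]
      exact Set.insert_subset (h2.1 (hq a)) (hte.trans h1.1)
  have hinj : Function.Injective F := by
    intro v w h
    obtain ⟨t, ht, hte⟩ := hcover {v, w}
    have hv := hF t ht v (hte (by simp))
    have hw := hF t ht w (hte (by simp))
    exact t.perm.injective (by rw [← hv, ← hw, h])
  have hsurj : Function.Surjective F := by
    intro w
    obtain ⟨t, ht, v, hv, rfl⟩ := him w
    exact ⟨v, hF t ht v hv⟩
  refine ⟨Equiv.ofBijective F ⟨hinj, hsurj⟩, isAut_iff.2 fun e _ => ?_, fun a ha => ?_,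
    fun x hx => hF p (Order.mem_idealOfCofinals p 𝒟) x hx⟩
  · obtain ⟨t, ht, hte⟩ := hcover e
    rw [← t.isoOn e hte]
    have : e.map (Equiv.ofBijective F ⟨hinj, hsurj⟩).toEmbedding = e.map t.perm.toEmbedding := by
      rw [Finset.map_eq_image, Finset.map_eq_image]
      exact Finset.image_congr fun x hx => hF t ht x (hte hx)
    rw [this]
  · exact (q a).fix a (hq a) ha

end PartialAut

/-- Membership in an orbit over the infinite set `dcl A₁` becomes a condition on finite sets. -/
theorem IsGeneric.mem_orb (hM : M.IsGeneric n m) (hm : 1 ≤ m) {A₁ E : Set V} (hE : E.Finite)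
    (hEs : M.IsStrong n m E) (hA₁ : A₁ ⊆ E) {σ : Equiv.Perm V} (hσ : IsoOn M M σ E)
    (hσs : M.IsStrong n m (σ '' E)) (hfix : ∀ x ∈ E, x ∈ M.dcl n m A₁ → σ x = x) {b : V}
    (hb : b ∈ E) : σ b ∈ M.orb (M.dcl n m A₁) b := by
  obtain ⟨g, h1, h2, h3⟩ :=
    PartialAut.exists_isAut hM hm ⟨E, σ, hE, hA₁, hEs, hσs, hσ, hfix⟩
  exact ⟨g, h1, h2, h3 b hb⟩

end Orbit

/-! ### Free amalgams and new hyperedges inside the generic structure -/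

section Realization

variable {r n m : ℕ} {V : Type*} {M : UniformHypergraph r V}

theorem map_one_toEmbedding (e : Finset V) :
    e.map (Equiv.toEmbedding (1 : Equiv.Perm V)) = e :=
  Finset.map_refl

theorem image_eq_self {σ : Equiv.Perm V} {X : Set V} (h : ∀ x ∈ X, σ x = x) : σ '' X = X := by
  rw [Set.image_congr h, Set.image_id']

theorem map_eq_self {σ : Equiv.Perm V} {e : Finset V} (h : ∀ x ∈ e, σ x = x) :
    e.map σ.toEmbedding = e := by
  rw [← Finset.coe_inj, Finset.coe_map]
  exact image_eq_self h

theorem IsoOn.trans {H H' H'' : UniformHypergraph r V} {σ τ : Equiv.Perm V} {S T : Set V}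
    (h : IsoOn H H' σ S) (h' : IsoOn H' H'' τ T) (hST : σ '' S ⊆ T) :
    IsoOn H H'' (σ.trans τ) S := by
  intro e he
  rw [← h e he, ← h' (e.map σ.toEmbedding), Finset.map_map]
  · rfl
  · rw [Finset.coe_map]
    exact (Set.image_mono he).trans hST

theorem IsoOn.exists_of_subset_image {H H' : UniformHypergraph r V} {σ : Equiv.Perm V} {S : Set V}
    (h : IsoOn H H' σ S) {e : Finset V} (he : e ∈ H'.edges) (heS : ↑e ⊆ σ '' S) :
    ∃ e₀ ∈ H.edges, ↑e₀ ⊆ S ∧ e₀.map σ.toEmbedding = e := by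
  have h1 : (e.map σ.symm.toEmbedding).map σ.toEmbedding = e := by
    ext x
    simp
  have h2 : ↑(e.map σ.symm.toEmbedding) ⊆ S := by
    rw [Finset.coe_map]
    rintro _ ⟨x, hx, rfl⟩
    obtain ⟨y, hy, rfl⟩ := heS hx
    simpa using hy
  exact ⟨_, (h _ h2).1 (h1.symm ▸ he), h2, h1⟩

theorem isStrong_empty (hM : M.MemC0 n m) (hr : 1 ≤ r) : M.IsStrong n m ∅ := by
  refine M.isStrong_of_delta_le Set.finite_empty fun B hB _ => ?_
  have : M.edgesIn ∅ = ∅ := by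
    refine Set.eq_empty_of_forall_notMem fun e he => ?_
    have h1 := M.card_eq e he.1
    have h2 : e = ∅ := by simpa using he.2
    rw [h2, Finset.card_empty] at h1
    omega
  refine le_trans ?_ (hM B hB)
  simp [delta, this]

/-- Otherwise an edgeless hypergraph with one point more than `V` would embed into `V`. -/
theorem IsGeneric.infinite (hM : M.IsGeneric n m) (hr : 1 ≤ r) : Infinite V := by
  by_contra hfin
  rw [not_infinite_iff_finite] at hfin
  let K : UniformHypergraph r (Fin (Nat.card V + 1)) := ⟨∅, by simp⟩
  have hK : ∀ S, 0 ≤ K.delta n m S := fun S => by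
    have : K.edgesIn S = ∅ := by simp [edgesIn, K]
    simp only [delta, this, Set.ncard_empty, Nat.cast_zero, mul_zero, sub_zero]
    positivity
  have hcomap : ∀ j : ↥(∅ : Set V) ↪ Fin (Nat.card V + 1),
      K.comap j = M.comap (Function.Embedding.subtype (· ∈ (∅ : Set V))) := by
    intro j
    unfold comap
    congr 1
    ext e
    have he : e = ∅ := by
      ext x
      exact x.2.elim
    subst he
    simp only [K, Set.mem_ofPred_eq, Set.mem_empty_iff_false, Finset.map_empty, false_iff]
    intro h
    have := M.card_eq _ h
    simp at this
    omega
  obtain ⟨α, -⟩ := hM.extension ∅ Set.finite_empty (isStrong_empty hM.memC0 hr) _ K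
    (fun S _ => hK S) ⟨fun x => x.2.elim, fun x => x.2.elim⟩ (hcomap _) (by
      refine isStrong_of_delta_le _ (Set.toFinite _) fun B _ _ => ?_
      have : Set.range (⟨fun x => x.2.elim, fun x => x.2.elim⟩ :
          ↥(∅ : Set V) ↪ Fin (Nat.card V + 1)) = ∅ := by
        ext x
        simp
      rw [this]
      refine le_trans ?_ (hK B)
      simp only [delta, Set.ncard_empty, Nat.cast_zero, mul_zero, zero_sub, Left.neg_nonpos_iff]
      positivity)
  have := Nat.card_le_card_of_injective α α.injective
  simp at this

theorem exists_perm_avoiding [Infinite V] {A E P : Set V} (hE : E.Finite) (hP : P.Finite)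
    (hAP : A ⊆ P) :
    ∃ τ : Equiv.Perm V, (∀ x ∈ E, x ∈ A → τ x = x) ∧ ∀ x ∈ E, x ∉ A → τ x ∉ P := by
  classical
  have : Finite E := hE
  have : Infinite ↥(Pᶜ) := hP.infinite_compl.to_subtype
  obtain ⟨N, ⟨eq⟩⟩ := Finite.exists_equiv_fin E
  let ι : E ↪ ↥(Pᶜ) := (eq.toEmbedding.trans Fin.valEmbedding).trans (Infinite.natEmbedding _)
  obtain ⟨τ, hτ⟩ := exists_perm_extending (Function.Embedding.subtype (· ∈ E))
    ⟨fun x => if (x : V) ∈ A then (x : V) else ι x, by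
      intro x y h
      simp only at h
      split_ifs at h with h1 h2 h2
      · exact Subtype.ext h
      · exact absurd (hAP h1) (h ▸ (ι y).2)
      · exact absurd (hAP h2) (h ▸ (ι x).2)
      · exact ι.injective (Subtype.ext h)⟩
  have hτ' : ∀ x (hx : x ∈ E), τ x = if x ∈ A then x else (ι ⟨x, hx⟩ : V) := fun x hx => hτ ⟨x, hx⟩
  refine ⟨τ, fun x hx h => ?_, fun x hx h => ?_⟩
  · rw [hτ' x hx, if_pos h]
  · rw [hτ' x hx, if_neg h]
    exact (ι _).2

/-- A new point without any relation to a given finite strong set. -/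
theorem IsGeneric.exists_free_point (hM : M.IsGeneric n m) (hr : 2 ≤ r) {P : Set V}
    (hP : P.Finite) (hPs : M.IsStrong n m P) :
    ∃ z, z ∉ P ∧ M.IsStrong n m (insert z P) ∧
      (∀ e ∈ M.edges, ↑e ⊆ insert z P → z ∉ e) ∧
      ∀ B : Set V, B ⊆ insert z P → z ∈ B → M.delta n m B = M.delta n m (B ∩ P) + n := by
  have := hM.infinite (by omega)
  obtain ⟨z₀, hz₀⟩ := hP.exists_notMem
  let H : UniformHypergraph r V := ⟨M.edgesIn P, fun e he => M.card_eq e he.1⟩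
  have hH : ∀ B ⊆ P, H.delta n m B = M.delta n m B := by
    intro B hB
    have : H.edgesIn B = M.edgesIn B := by
      ext e
      exact ⟨fun h => ⟨h.1.1, h.2⟩, fun h => ⟨⟨h.1, h.2.trans hB⟩, h.2⟩⟩
    rw [delta, delta, this]
  have hle : ∀ B : Set V, P ⊆ B → B ⊆ insert z₀ P → H.delta n m P ≤ H.delta n m B := by
    intro B hPB hB
    have h1 : H.edgesIn B = H.edgesIn P := by
      ext e
      exact ⟨fun h => ⟨h.1, h.1.2⟩, fun h => ⟨h.1, h.2.trans hPB⟩⟩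
    have h2 := Set.ncard_le_ncard hPB ((hP.insert z₀).subset hB)
    rw [delta, delta, h1]
    gcongr
  obtain ⟨σ, h1, h2, h3⟩ := hM.exists_extension (H := H) (X := P) (g := 1) (hP.insert z₀)
    (Set.subset_insert _ _) (fun e he => by
      rw [map_one_toEmbedding]
      exact ⟨fun h => ⟨h, he⟩, fun h => h.1⟩)
    (by simpa [Equiv.Perm.one_def] using hPs) hle
  have h4 : σ '' (insert z₀ P) = insert (σ z₀) P := by
    rw [Set.image_insert_eq, image_eq_self h1]
  rw [h4] at h3
  have hz : σ z₀ ∉ P := by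
    intro h
    have := h1 _ h
    exact hz₀ (σ.injective this ▸ h)
  have hedge : ∀ e ∈ M.edges, ↑e ⊆ insert (σ z₀) P → σ z₀ ∉ e := by
    intro e he heQ hze
    obtain ⟨e₀, he₀, -, rfl⟩ := h2.exists_of_subset_image he (h4.symm ▸ heQ)
    have : z₀ ∈ e₀ := by simpa using hze
    exact hz₀ (he₀.2 this)
  refine ⟨σ z₀, hz, h3, hedge, fun B hB hzB => ?_⟩
  have h5 : B = insert (σ z₀) (B ∩ P) := by
    ext x
    constructor
    · intro hx
      rcases hB hx with h | h
      · exact Or.inl h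
      · exact Or.inr ⟨hx, h⟩
    · rintro (h | h)
      · exact h ▸ hzB
      · exact h.1
  have h6 : M.edgesIn B = M.edgesIn (B ∩ P) := by
    ext e
    refine ⟨fun h => ⟨h.1, fun x hx => ?_⟩, fun h => ⟨h.1, h.2.trans Set.inter_subset_left⟩⟩
    refine ⟨h.2 hx, (hB (h.2 hx)).resolve_left ?_⟩
    rintro rfl
    exact hedge e h.1 (h.2.trans hB) hx
  have h7 : B.ncard = (B ∩ P).ncard + 1 := by
    conv_lhs => rw [h5]
    exact Set.ncard_insert_of_notMem (fun h => hz h.2) (hP.subset Set.inter_subset_right)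
  rw [delta, delta, h6, h7]
  push_cast
  ring

variable (n m M) in
/-- `A₁` is a finite strong base over which `u` has dimension `k`, and which contains all the
elements of `cl₀(A₁ u)` that are `d`-dependent on it. -/
structure IsBase (A₁ : Set V) (u : V) (k : ℤ) : Prop where
  finite : A₁.Finite
  isStrong : M.IsStrong n m A₁
  pos : 0 < k
  dim_eq : M.dim n m ({u} ∪ A₁) = M.delta n m A₁ + k
  inter_subset : M.cl0 n m ({u} ∪ A₁) ∩ M.dcl n m A₁ ⊆ A₁

variable {A₁ : Set V} {u : V} {k : ℤ}

/-- `Q` realises the free amalgam of `P` and `cl0({u} ∪ A₁)` over `A₁`. Both pieces are strong in it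
because `A₁` is strong. The clause on hyperedges later shows that an attached hyperedge is really
new. -/
theorem exists_copy (hM : M.IsGeneric n m) (hm : 1 ≤ m) (hr : 2 ≤ r) (hA : IsBase n m M A₁ u k)
    {P : Set V} (hP : P.Finite) (hPs : M.IsStrong n m P) (hAP : A₁ ⊆ P) :
    ∃ u' ∈ M.orb (M.dcl n m A₁) u, ∃ Q : Set V, Q.Finite ∧ M.IsStrong n m Q ∧ P ⊆ Q ∧ u' ∈ Q ∧
      u' ∉ P ∧
      (∀ B : Set V, A₁ ⊆ B → B ⊆ Q → u' ∈ B → M.delta n m (B ∩ P) + k ≤ M.delta n m B) ∧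
      M.delta n m Q = M.delta n m P + k ∧
      ∀ e ∈ M.edges, ↑e ⊆ Q → ↑e ⊆ P ∨ ↑e ∩ P ⊆ A₁ := by
  have hC := hM.memC0
  have := hM.infinite (by omega)
  have hAu : ({u} ∪ A₁).Finite := (Set.finite_singleton u).union hA.finite
  obtain ⟨hE, hEs, -⟩ := cl0_spec hC hAu
  have hEdef : M.delta n m (M.cl0 n m ({u} ∪ A₁)) = M.delta n m A₁ + k := hA.dim_eq
  have hEsub : {u} ∪ A₁ ⊆ M.cl0 n m ({u} ∪ A₁) := subset_cl0 _
  have hEi := hA.inter_subset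
  set E := M.cl0 n m ({u} ∪ A₁)
  have hAE : A₁ ⊆ E := Set.subset_union_right.trans hEsub
  have huE : u ∈ E := hEsub (Or.inl rfl)
  have huA : u ∉ A₁ := by
    intro h
    have h1 := hA.dim_eq
    rw [Set.union_eq_right.2 (Set.singleton_subset_iff.2 h), dim_eq_delta hA.isStrong] at h1
    linarith [hA.pos]
  obtain ⟨τ, hτ1', hτ2⟩ := exists_perm_avoiding hE hP hAP
  have hτ1 : ∀ x ∈ A₁, τ x = x := fun x hx => hτ1' x (hAE hx) hx
  have hinter : ∀ x ∈ P, x ∈ τ '' E → x ∈ A₁ := by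
    rintro _ hxP ⟨x, hx, rfl⟩
    by_cases h : x ∈ A₁
    · rwa [hτ1 x h]
    · exact absurd hxP (hτ2 x hx h)
  have hsmall : ∀ e : Finset V, ↑e ⊆ E → ↑(e.map τ.toEmbedding) ⊆ P →
      e.map τ.toEmbedding = e := by
    intro e he h
    refine map_eq_self fun x hx => hτ1 x ?_
    by_contra hxA
    exact hτ2 x (he hx) hxA (h (Finset.mem_coe.2 (Finset.mem_map_of_mem _ hx)))
  let H : UniformHypergraph r V := ⟨M.edgesIn P ∪ Finset.map τ.toEmbedding '' M.edgesIn E, by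
    rintro e (h | ⟨e, h, rfl⟩)
    · exact M.card_eq e h.1
    · rw [Finset.card_map]
      exact M.card_eq e h.1⟩
  have hHP : IsoOn M H 1 P := by
    intro e he
    rw [map_one_toEmbedding]
    refine ⟨?_, fun h => Or.inl ⟨h, he⟩⟩
    rintro (h | ⟨e', h, rfl⟩)
    · exact h.1
    · rw [hsmall e' h.2 he]
      exact h.1
  have hHE : IsoOn M H τ E := by
    intro e he
    refine ⟨?_, fun h => Or.inr ⟨e, ⟨h, he⟩, rfl⟩⟩
    rintro (h | ⟨e', h, h'⟩)
    · rw [← hsmall e he h.2]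
      exact h.1
    · rw [← Finset.map_injective _ h']
      exact h.1
  have hδP : ∀ B ⊆ P, H.delta n m B = M.delta n m B := by
    intro B hB
    simpa using hHP.delta_image (n := n) (m := m) hB
  have hτA : τ '' A₁ = A₁ := image_eq_self hτ1
  -- A set containing `A₁` is itself the free amalgam of its traces on the two pieces; `C` is the
  -- second trace, pulled back to `E`.
  have hδ : ∀ B : Set V, A₁ ⊆ B → B ⊆ P ∪ τ '' E → ∃ C : Set V, A₁ ⊆ C ∧ C ⊆ E ∧
      τ '' C = B ∩ τ '' E ∧
      H.delta n m B + M.delta n m A₁ = M.delta n m (B ∩ P) + M.delta n m C := by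
    intro B hAB hB
    obtain ⟨C, hCE, hC'⟩ := Set.subset_image_iff.1 (Set.inter_subset_right (s := B) (t := τ '' E))
    refine ⟨C, ?_, hCE, hC', ?_⟩
    · rw [← Set.image_subset_image_iff τ.injective, hC', hτA]
      exact Set.subset_inter hAB (hτA.symm.trans_subset (Set.image_mono hAE))
    · have h1 : (B ∩ P) ∪ (B ∩ τ '' E) = B := by
        rw [← Set.inter_union_distrib_left, Set.inter_eq_left.2 hB]
      have h2 : (B ∩ P) ∩ (B ∩ τ '' E) = A₁ := by
        ext x
        constructor
        · rintro ⟨h, h'⟩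
          exact hinter x h.2 h'.2
        · intro hx
          exact ⟨⟨hAB hx, hAP hx⟩, hAB hx, x, hAE hx, hτ1 x hx⟩
      have h3 := H.delta_union_inter_of_edges (n := n) (m := m)
        (hP.subset (Set.inter_subset_right (s := B)))
        ((hE.image τ).subset (Set.inter_subset_right (s := B))) (by
          rw [h1]
          rintro e ⟨h | ⟨e, h, rfl⟩, heB⟩
          · exact Or.inl ⟨Or.inl h, Set.subset_inter heB h.2⟩
          · refine Or.inr ⟨Or.inr ⟨e, h, rfl⟩, Set.subset_inter heB ?_⟩
            rw [Finset.coe_map]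
            exact Set.image_mono h.2)
      rw [h1, h2, hδP _ hAP, hδP _ Set.inter_subset_right, ← hC', hHE.delta_image hCE] at h3
      exact h3
  have hPE : (P ∪ τ '' E).Finite := hP.union (hE.image τ)
  obtain ⟨σ, hσ1, hσ2, hσ3⟩ := hM.exists_extension (H := H) (X := P) (g := 1) hPE
    Set.subset_union_left (fun e he => by
      have := hHP e he
      rw [map_one_toEmbedding] at this ⊢
      exact this.symm)
    (by simpa [Equiv.Perm.one_def] using hPs) (fun B hPB hB => by
      obtain ⟨C, hAC, hCE, -, h⟩ := hδ B (hAP.trans hPB) hB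
      rw [Set.inter_eq_right.2 hPB] at h
      have := hA.isStrong.delta_le (hE.subset hCE) hAC
      rw [hδP P subset_rfl]
      linarith)
  have hBP : ∀ B₀ : Set V, σ '' B₀ ∩ P = B₀ ∩ P := by
    intro B₀
    ext x
    constructor
    · rintro ⟨⟨y, hy, rfl⟩, h⟩
      have h1 : σ y = y := σ.injective (hσ1 _ h)
      rw [h1] at h ⊢
      exact ⟨hy, h⟩
    · rintro ⟨h, h'⟩
      exact ⟨⟨x, h, hσ1 x h'⟩, h'⟩
  have hσP : ∀ x, σ x ∈ P → σ x = x := fun x h => σ.injective (hσ1 _ h)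
  refine ⟨σ (τ u), ?_, σ '' (P ∪ τ '' E), hPE.image σ, hσ3, ?_, ?_, ?_, ?_, ?_, ?_⟩
  · refine hM.mem_orb hm hE hEs hAE (σ := τ.trans σ) (hHE.trans hσ2 Set.subset_union_right) ?_ ?_
      huE
    · have := hσ2.isStrong_image hPE hσ3 (C := τ '' E) Set.subset_union_right (fun B hEB hB => by
        have hAB : A₁ ⊆ B := fun x hx => hEB ⟨x, hAE hx, hτ1 x hx⟩
        obtain ⟨C, -, hCE, hC', h⟩ := hδ B hAB hB
        rw [Set.inter_eq_right.2 hEB] at hC'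
        rw [(Set.image_injective.2 τ.injective) hC'] at h
        rw [hHE.delta_image subset_rfl]
        have := hA.isStrong.delta_le (hP.subset (Set.inter_subset_right (s := B)))
          (Set.subset_inter hAB hAP)
        linarith)
      rwa [← Set.image_comp] at this
    · intro x hx hx'
      have := hEi ⟨hx, hx'⟩
      rw [Equiv.trans_apply, hτ1 x this]
      exact hσ1 x (hAP this)
  · exact fun x hx => ⟨x, Or.inl hx, hσ1 x hx⟩
  · exact ⟨τ u, Or.inr ⟨u, huE, rfl⟩, rfl⟩
  · intro h
    rw [hσP _ h] at h
    exact hτ2 u huE huA h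
  · intro B hAB hB huB
    obtain ⟨B₀, hB₀, rfl⟩ := Set.subset_image_iff.1 hB
    have hAB₀ : A₁ ⊆ B₀ := by
      rw [← Set.image_subset_image_iff σ.injective, image_eq_self fun x hx => hσ1 x (hAP hx)]
      exact hAB
    obtain ⟨C, hAC, hCE, hC', h⟩ := hδ B₀ hAB₀ hB₀
    have huC : u ∈ C := by
      have h1 : τ u ∈ τ '' C := by
        rw [hC']
        exact ⟨σ.injective.mem_set_image.1 huB, u, huE, rfl⟩
      exact τ.injective.mem_set_image.1 h1
    have h2 := dim_le_delta (n := n) (m := m) hC (hE.subset hCE)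
      (Set.union_subset (Set.singleton_subset_iff.2 huC) hAC)
    rw [hA.dim_eq] at h2
    rw [hBP, hσ2.delta_image hB₀]
    linarith
  · obtain ⟨C, -, hCE, hC', h⟩ := hδ _ (hAP.trans Set.subset_union_left) subset_rfl
    rw [Set.inter_eq_right.2 Set.subset_union_right] at hC'
    rw [(Set.image_injective.2 τ.injective) hC', Set.inter_eq_right.2 Set.subset_union_left] at h
    rw [hσ2.delta_image subset_rfl]
    linarith
  · intro e he heQ
    obtain ⟨e₀, he₀, -, rfl⟩ := hσ2.exists_of_subset_image he heQ
    rcases he₀ with h | ⟨e₁, h, rfl⟩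
    · left
      rw [Finset.coe_map]
      rintro _ ⟨x, hx, rfl⟩
      change σ x ∈ P
      rw [hσ1 x (h.2 hx)]
      exact h.2 hx
    · right
      rintro x ⟨hx, hxP⟩
      rw [Finset.coe_map, Finset.coe_map] at hx
      obtain ⟨_, ⟨y, hy, rfl⟩, rfl⟩ := hx
      change σ (τ y) ∈ P at hxP
      change σ (τ y) ∈ A₁
      have h1 := hσP _ hxP
      rw [h1] at hxP ⊢
      exact hinter _ hxP ⟨y, h.2 hy, rfl⟩

/-- Each copy is taken free over everything before it, so every copy lying in `B` contributes its
own `k`. -/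
theorem exists_copies (hM : M.IsGeneric n m) (hm : 1 ≤ m) (hr : 2 ≤ r) (hA : IsBase n m M A₁ u k)
    {P : Set V} (hP : P.Finite) (hPs : M.IsStrong n m P) (hAP : A₁ ⊆ P) (T : ℕ) :
    ∃ (U : Finset V) (Q : Set V), U.card = T ∧ (∀ x ∈ U, x ∈ M.orb (M.dcl n m A₁) u) ∧
      (∀ x ∈ U, x ∉ P) ∧ Q.Finite ∧ M.IsStrong n m Q ∧ P ⊆ Q ∧ ↑U ⊆ Q ∧
      (∀ B : Set V, A₁ ⊆ B → B ⊆ Q →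
        M.delta n m (B ∩ P) + k * (↑U ∩ B : Set V).ncard ≤ M.delta n m B) ∧
      M.delta n m Q = M.delta n m P + k * T ∧
      ∀ e ∈ M.edges, ↑e ⊆ Q → ↑e ⊆ P ∨ ↑e ∩ P ⊆ A₁ := by
  classical
  induction T with
  | zero =>
    refine ⟨∅, P, rfl, by simp, by simp, hP, hPs, subset_rfl, by simp, ?_, by simp,
      fun e _ h => Or.inl h⟩
    intro B _ hB
    simp [Set.inter_eq_left.2 hB]
  | succ T ih =>
    obtain ⟨U, Q, hUT, hUo, hUP, hQ, hQs, hPQ, hUQ, hδ, hδQ, he⟩ := ih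
    obtain ⟨u', hu'o, Q', hQ', hQs', hQQ', hu'Q', hu'Q, hδ', hδQ', he'⟩ :=
      exists_copy hM hm hr hA hQ hQs (hAP.trans hPQ)
    have hu'U : u' ∉ U := fun h => hu'Q (hUQ h)
    refine ⟨insert u' U, Q', ?_, ?_, ?_, hQ', hQs', hPQ.trans hQQ', ?_, ?_, ?_, ?_⟩
    · rw [Finset.card_insert_of_notMem hu'U, hUT]
    · intro x hx
      rcases Finset.mem_insert.1 hx with rfl | h
      · exact hu'o
      · exact hUo x h
    · intro x hx
      rcases Finset.mem_insert.1 hx with rfl | h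
      · exact fun h => hu'Q (hPQ h)
      · exact hUP x h
    · rw [Finset.coe_insert]
      exact Set.insert_subset hu'Q' (hUQ.trans hQQ')
    · intro B hAB hB
      have h1 := hδ (B ∩ Q) (Set.subset_inter hAB (hAP.trans hPQ)) Set.inter_subset_right
      have h2 : (↑U ∩ (B ∩ Q) : Set V) = ↑U ∩ B := by
        rw [Set.inter_comm B Q, ← Set.inter_assoc, Set.inter_eq_left.2 hUQ]
      rw [h2, Set.inter_assoc, Set.inter_eq_right.2 hPQ] at h1
      rw [Finset.coe_insert]
      by_cases h : u' ∈ B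
      · have h3 := hδ' B hAB hB h
        rw [Set.insert_inter_of_mem h, Set.ncard_insert_of_notMem (fun h => hu'U h.1)
          (U.finite_toSet.subset Set.inter_subset_left)]
        push_cast
        linarith
      · have h3 := hQs.delta_inter_le (hQ'.subset hB)
        rw [Set.insert_inter_of_notMem h]
        linarith
    · rw [hδQ', hδQ]
      push_cast
      ring
    · intro e heM heQ
      rcases he' e heM heQ with h | h
      · exact he e heM h
      · exact Or.inr ((Set.inter_subset_inter_right _ hPQ).trans h)

/-- The hypergraph with one more hyperedge. -/
def insertEdge (H : UniformHypergraph r V) (e : Finset V) (he : e.card = r) :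
    UniformHypergraph r V where
  edges := insert e H.edges
  card_eq := by
    rintro _ (rfl | h)
    · exact he
    · exact H.card_eq _ h

theorem delta_insertEdge_of_not_subset {e : Finset V} (he : e.card = r) {B : Set V}
    (h : ¬ ↑e ⊆ B) : (M.insertEdge e he).delta n m B = M.delta n m B := by
  have : (M.insertEdge e he).edgesIn B = M.edgesIn B := by
    ext e'
    constructor
    · rintro ⟨rfl | h1, h2⟩
      · exact absurd h2 h
      · exact ⟨h1, h2⟩
    · exact fun h1 => ⟨Or.inr h1.1, h1.2⟩
  rw [delta, delta, this]

theorem delta_insertEdge_of_subset {e : Finset V} (he : e.card = r) (heM : e ∉ M.edges)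
    {B : Set V} (hB : B.Finite) (h : ↑e ⊆ B) :
    (M.insertEdge e he).delta n m B = M.delta n m B - m := by
  have : (M.insertEdge e he).edgesIn B = insert e (M.edgesIn B) := by
    ext e'
    constructor
    · rintro ⟨rfl | h1, h2⟩
      · exact Or.inl rfl
      · exact Or.inr ⟨h1, h2⟩
    · rintro (rfl | h1)
      · exact ⟨Or.inl rfl, h⟩
      · exact ⟨Or.inr h1.1, h1.2⟩
  rw [delta, delta, this, Set.ncard_insert_of_notMem (fun h => heM h.1) (M.edgesIn_finite hB)]
  push_cast
  ring

/-- `σ '' Q` realises `Q` with the extra hyperedge `J ∪ U`. The bound `hX` keeps `X` strong despite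
the loss of `m`; `hJA` and `hJM` ensure that the hyperedge was not there before. For the last
clause, a copy of `u` has closure of predimension `δ(A₁) + k` over `A₁`. Under the stated bound no
set containing the new hyperedge falls below this value, so that closure stays strong and the point
stays conjugate to `u`. -/
theorem exists_attach (hM : M.IsGeneric n m) (hm : 1 ≤ m) (hr : 2 ≤ r)
    (hA : IsBase n m M A₁ u k) {P X : Set V} {J : Finset V} {T : ℕ} (hT : J.card + T = r)
    (hP : P.Finite) (hPs : M.IsStrong n m P) (hAX : A₁ ⊆ X) (hXP : X ⊆ P)
    (hXs : M.IsStrong n m X) (hJP : ↑J ⊆ P) (hJA : ¬ ↑J ⊆ A₁) (hJM : J ∉ M.edges)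
    (hX : ∀ B : Set V, X ⊆ B → B ⊆ P → ↑J ⊆ B →
      M.delta n m X + m ≤ M.delta n m B + k * T) :
    ∃ (σ : Equiv.Perm V) (Q : Set V) (U : Finset V), U.card = T ∧
      (∀ x ∈ U, x ∈ M.orb (M.dcl n m A₁) u) ∧ (∀ x ∈ U, x ∉ P) ∧ Q.Finite ∧ P ⊆ Q ∧ ↑U ⊆ Q ∧
      (∀ x ∈ X, σ x = x) ∧ M.IsStrong n m (σ '' Q) ∧
      (∀ B : Set V, A₁ ⊆ B → B ⊆ Q →
        M.delta n m (B ∩ P) + k * (↑U ∩ B : Set V).ncard ≤ M.delta n m B) ∧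
      M.delta n m Q = M.delta n m P + k * T ∧
      (∀ B ⊆ Q, ¬ (↑J ⊆ B ∧ ↑U ⊆ B) → M.delta n m (σ '' B) = M.delta n m B) ∧
      (∀ B ⊆ Q, ↑J ⊆ B → ↑U ⊆ B → M.delta n m (σ '' B) = M.delta n m B - m) ∧
      ((∀ B : Set V, A₁ ⊆ B → B ⊆ P → ↑J ⊆ B →
          M.delta n m A₁ + k + m ≤ M.delta n m B + k * T) →
        ∀ x ∈ Q, x ∈ M.orb (M.dcl n m A₁) u → σ x ∈ M.orb (M.dcl n m A₁) u) := by
  classical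
  have hC := hM.memC0
  obtain ⟨U, Q, hUT, hUo, hUP, hQ, hQs, hPQ, hUQ, hδ, hδQ, he⟩ :=
    exists_copies hM hm hr hA hP hPs (hAX.trans hXP) T
  have hm0 : (0 : ℤ) < m := by exact_mod_cast hm
  have hdisj : Disjoint J U := Finset.disjoint_left.2 fun x hx hxU => hUP x hxU (hJP hx)
  set e₀ := J ∪ U with he₀
  have hcard : e₀.card = r := by rw [he₀, Finset.card_union_of_disjoint hdisj, hUT, hT]
  have hsub : ∀ B : Set V, ↑e₀ ⊆ B ↔ ↑J ⊆ B ∧ ↑U ⊆ B := fun B => by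
    rw [he₀, Finset.coe_union, Set.union_subset_iff]
  have hUempty : ↑U ⊆ P → U = ∅ := fun h =>
    Finset.eq_empty_of_forall_notMem fun x hx => hUP x hx (h hx)
  have he₀M : e₀ ∉ M.edges := by
    intro h
    rcases he e₀ h ((hsub Q).2 ⟨hJP.trans hPQ, hUQ⟩) with h1 | h1
    · have := hUempty ((hsub P).1 h1).2
      rw [he₀, this, Finset.union_empty] at h
      exact hJM h
    · refine hJA fun x hx => h1 ⟨?_, hJP hx⟩
      exact ((hsub _).1 subset_rfl).1 hx
  have hbig : ∀ B : Set V, A₁ ⊆ B → B ⊆ Q → ↑e₀ ⊆ B →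
      M.delta n m (B ∩ P) + k * T ≤ M.delta n m B := by
    intro B hAB hB heB
    have h1 := hδ B hAB hB
    rwa [Set.inter_eq_left.2 ((hsub B).1 heB).2, Set.ncard_coe_finset, hUT] at h1
  set H := M.insertEdge e₀ hcard
  have hH1 : ∀ B : Set V, ¬ ↑e₀ ⊆ B → H.delta n m B = M.delta n m B :=
    fun B h => delta_insertEdge_of_not_subset hcard h
  have hH2 : ∀ B : Set V, B ⊆ Q → ↑e₀ ⊆ B → H.delta n m B = M.delta n m B - m :=
    fun B hB h => delta_insertEdge_of_subset hcard he₀M (hQ.subset hB) h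
  have hHiso : ∀ S : Set V, ¬ ↑e₀ ⊆ S → ∀ e : Finset V, ↑e ⊆ S →
      (e ∈ H.edges ↔ e ∈ M.edges) := by
    intro S hS e heS
    refine ⟨fun h => h.resolve_left ?_, Or.inr⟩
    rintro rfl
    exact hS heS
  -- Otherwise `U` is empty and `T = 0`, and `hX` for `B = X` reads `m ≤ 0`.
  have heX : ¬ ↑e₀ ⊆ X := by
    intro h
    have h1 := hUempty (((hsub X).1 h).2.trans hXP)
    have h2 := hX X subset_rfl hXP ((hsub X).1 h).1
    have h3 : T = 0 := by rw [← hUT, h1, Finset.card_empty]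
    rw [h3] at h2
    simp at h2
    omega
  obtain ⟨σ, hσ1, hσ2, hσ3⟩ := hM.exists_extension (H := H) (X := X) (g := 1) hQ
    (hXP.trans hPQ) (fun e he => by
      rw [map_one_toEmbedding]
      exact (hHiso X heX e he).symm)
    (by simpa [Equiv.Perm.one_def] using hXs) (fun B hXB hB => by
      rw [hH1 X heX]
      by_cases h : ↑e₀ ⊆ B
      · have h1 := hbig B (hAX.trans hXB) hB h
        have h2 := hX (B ∩ P) (Set.subset_inter hXB hXP) Set.inter_subset_right
          (Set.subset_inter ((hsub B).1 h).1 hJP)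
        rw [hH2 B hB h]
        linarith
      · rw [hH1 B h]
        exact hXs.delta_le (hQ.subset hB) hXB)
  refine ⟨σ, Q, U, hUT, hUo, hUP, hQ, hPQ, hUQ, hσ1, hσ3, hδ, hδQ, ?_, ?_, ?_⟩
  · intro B hB h
    rw [hσ2.delta_image hB, hH1 B ((hsub B).not.2 h)]
  · intro B hB h h'
    rw [hσ2.delta_image hB, hH2 B hB ((hsub B).2 ⟨h, h'⟩)]
  · rintro hb _ hxQ ⟨g, hg, hgfix, rfl⟩
    have hAQ : A₁ ⊆ Q := (hAX.trans hXP).trans hPQ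
    have hgA : g '' A₁ = A₁ := image_eq_self fun x hx => hgfix x (subset_dcl hC _ hx)
    have hAu : ({u} ∪ A₁).Finite := (Set.finite_singleton u).union hA.finite
    have hgAu : ({g u} ∪ A₁).Finite := (Set.finite_singleton _).union hA.finite
    have himg : g '' ({u} ∪ A₁) = {g u} ∪ A₁ := by
      rw [Set.image_union, Set.image_singleton, hgA]
    obtain ⟨hE, hEs, -⟩ := cl0_spec (n := n) (m := m) hC hgAu
    have hEQ : M.cl0 n m ({g u} ∪ A₁) ⊆ Q :=
      cl0_subset hQs (Set.union_subset (Set.singleton_subset_iff.2 hxQ) hAQ)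
    have hEsub : {g u} ∪ A₁ ⊆ M.cl0 n m ({g u} ∪ A₁) := subset_cl0 _
    have hEδ : M.delta n m (M.cl0 n m ({g u} ∪ A₁)) = M.delta n m A₁ + k := by
      rw [← hA.dim_eq, ← hg.dim_image hC hAu, himg]
      rfl
    have hEi : M.cl0 n m ({g u} ∪ A₁) ∩ M.dcl n m A₁ ⊆ A₁ := by
      rw [← himg, hg.cl0_image hC hAu]
      rintro _ ⟨⟨y, hy, rfl⟩, h⟩
      have h1 := g.injective (hgfix _ h)
      rw [h1] at h ⊢
      exact hA.inter_subset ⟨hy, h⟩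
    set E := M.cl0 n m ({g u} ∪ A₁)
    have hAE : A₁ ⊆ E := Set.subset_union_right.trans hEsub
    have hbigE : ∀ B : Set V, A₁ ⊆ B → B ⊆ Q → ↑e₀ ⊆ B →
        M.delta n m A₁ + k + m ≤ M.delta n m B := by
      intro B hAB hB h
      have h1 := hbig B hAB hB h
      have h2 := hb (B ∩ P) (Set.subset_inter hAB (hAX.trans hXP)) Set.inter_subset_right
        (Set.subset_inter ((hsub B).1 h).1 hJP)
      linarith
    have heE : ¬ ↑e₀ ⊆ E := fun h => by
      have := hbigE E hAE hEQ h
      linarith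
    have hiso : IsoOn M M σ E := fun e he => by
      rw [hσ2 e (he.trans hEQ), hHiso E heE e he]
    have h1 := hM.mem_orb hm hE hEs hAE hiso (hσ2.isStrong_image hQ hσ3 hEQ fun B hEB hB => by
        rw [hH1 E heE, hEδ]
        by_cases h : ↑e₀ ⊆ B
        · have := hbigE B (hAE.trans hEB) hB h
          rw [hH2 B hB h]
          linarith
        · rw [hH1 B h, ← hEδ]
          exact hEs.delta_le (hQ.subset hB) hEB)
      (fun x hx hx' => hσ1 x (hAX (hEi ⟨hx, hx'⟩))) (hEsub (Or.inl rfl))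
    obtain ⟨g', hg', hg'fix, h2⟩ := h1
    exact ⟨g.trans g', hg.trans hg', fun a ha => by
      rw [Equiv.trans_apply, hgfix a ha, hg'fix a ha], h2⟩

end Realization

/-! ### Absorbing points into the closure of an orbit -/

section Spanning

variable {r n m : ℕ} {V : Type*} {M : UniformHypergraph r V} {A₁ : Set V} {u : V} {k : ℤ}

theorem subset_of_subset_image {σ : Equiv.Perm V}
    (hσ : ∀ x ∈ A₁, σ x = x) {B : Set V} (h : A₁ ⊆ σ '' B) : A₁ ⊆ B := by
  rw [← Set.image_subset_image_iff σ.injective, image_eq_self hσ]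
  exact h

/-- If `v ∉ S`, put a hyperedge on `v` and `T` free copies of `u`. Here `h₁` keeps `cl0({v} ∪ Y)`
strong, and `h₂` keeps the copies in the orbit, hence in `S`. Adding them to `Y` lowers the positive
integer `d(v/Y)`, which cannot go on forever. -/
theorem IsBase.mem_of_dim_eq (hM : M.IsGeneric n m) (hm : 1 ≤ m) (hr : 2 ≤ r)
    (hA : IsBase n m M A₁ u k) {S : Set V} (hS : M.dcl n m S ⊆ S) (hAS : A₁ ⊆ S)
    (horb : M.orb (M.dcl n m A₁) u ⊆ S) {v : V} {p : ℤ} {T : ℕ} (hT : 1 + T = r)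
    (hp : M.dim n m ({v} ∪ A₁) = M.delta n m A₁ + p) (h₁ : (m : ℤ) ≤ k * T)
    (h₂ : k + m ≤ p + k * T) : v ∈ S := by
  have hC := hM.memC0
  have hm0 : (0 : ℤ) < m := by exact_mod_cast hm
  by_contra hv
  have hlt : ∀ Y : Set V, Y.Finite → Y ⊆ S → M.dim n m Y < M.dim n m ({v} ∪ Y) := by
    intro Y hY hYS
    by_contra h
    exact hv (hS (dcl_mono hC hYS (mem_dcl_of_dim_le hC hY (not_lt.1 h))))
  suffices h : ∀ N : ℕ, ∀ Y : Set V, Y.Finite → A₁ ⊆ Y → Y ⊆ S →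
      (M.dim n m ({v} ∪ Y) - M.dim n m Y).toNat = N → False from
    h _ A₁ hA.finite subset_rfl hAS rfl
  intro N
  induction N using Nat.strong_induction_on with
  | _ N ih =>
    intro Y hY hAY hYS hN
    have hvY : ({v} ∪ Y).Finite := (Set.finite_singleton v).union hY
    obtain ⟨hP, hPs, hPmin⟩ := cl0_spec (n := n) (m := m) hC hvY
    have hPsub : {v} ∪ Y ⊆ M.cl0 n m ({v} ∪ Y) := subset_cl0 _
    have hPδ : M.delta n m (M.cl0 n m ({v} ∪ Y)) = M.dim n m ({v} ∪ Y) := rfl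
    set P := M.cl0 n m ({v} ∪ Y)
    have hvP : v ∈ P := hPsub (Or.inl rfl)
    have hYP : Y ⊆ P := Set.subset_union_right.trans hPsub
    obtain ⟨σ, Q, U, hUT, hUo, hUP, hQ, hPQ, hUQ, hσ, hσs, hδ, hδQ, hd1, hd2, ho⟩ :=
      exists_attach hM hm hr hA (P := P) (X := P) (J := {v}) (T := T) (by simpa using hT) hP hPs
        (hAY.trans hYP) subset_rfl hPs (by simpa using hvP)
        (fun h => hv (hAS (h (by simp)))) (fun h => by
          have := M.card_eq _ h
          rw [Finset.card_singleton] at this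
          omega)
        (fun B hPB hBP _ => by
          rw [hPB.antisymm hBP]
          linarith)
    have hoU : ∀ x ∈ U, σ x ∈ S := fun x hx => horb (ho (fun B hAB hBP hB => by
      have h1 := dim_le_delta (n := n) (m := m) hC (X := {v} ∪ A₁) (hP.subset hBP)
        (Set.union_subset (by simpa using hB) hAB)
      rw [hp] at h1
      linarith) x (hUQ hx) (hUo x hx))
    have hσY : σ '' Y = Y := image_eq_self fun x hx => hσ x (hYP hx)
    have hY'im : Y ∪ σ '' ↑U = σ '' (Y ∪ ↑U) := by rw [Set.image_union, hσY]
    have hY' : (Y ∪ σ '' ↑U).Finite := hY.union (U.finite_toSet.image σ)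
    have hY'S : Y ∪ σ '' ↑U ⊆ S := by
      refine Set.union_subset hYS ?_
      rintro _ ⟨x, hx, rfl⟩
      exact hoU x hx
    have hYUQ : Y ∪ ↑U ⊆ Q := Set.union_subset (hYP.trans hPQ) hUQ
    have hup : M.dim n m ({v} ∪ (Y ∪ σ '' ↑U)) ≤ M.dim n m ({v} ∪ Y) + k * T - m := by
      refine (dim_le_delta hC (hQ.image σ) ?_).trans ?_
      · refine Set.union_subset ?_ ?_
        · rw [Set.singleton_subset_iff]
          exact ⟨v, hPQ hvP, hσ v hvP⟩
        · rw [hY'im]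
          exact Set.image_mono hYUQ
      · rw [hd2 Q subset_rfl (by simpa using hPQ hvP) hUQ, hδQ, hPδ]
    have hcl : M.cl0 n m (Y ∪ σ '' ↑U) ⊆ σ '' Q := cl0_subset hσs (by
      rw [hY'im]
      exact Set.image_mono hYUQ)
    obtain ⟨B, hBQ, hB⟩ := Set.subset_image_iff.1 hcl
    have hYUB : Y ∪ ↑U ⊆ B := by
      rw [← Set.image_subset_image_iff σ.injective, hB, ← hY'im]
      exact subset_cl0 _
    have hdimB : M.dim n m (Y ∪ σ '' ↑U) = M.delta n m (σ '' B) := by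
      rw [hB]
      rfl
    have hYB : Y ⊆ B := Set.subset_union_left.trans hYUB
    have hUB : ↑U ⊆ B := Set.subset_union_right.trans hYUB
    have h3 := hδ B (hAY.trans hYB) hBQ
    rw [Set.inter_eq_left.2 hUB, Set.ncard_coe_finset, hUT] at h3
    have h4 := hlt _ hY' hY'S
    -- If the closure of the enlarged `Y` contains `v`, its dimension reaches the bound `hup`,
    -- against `h4`. Otherwise the new hyperedge is not counted in it, and `d(v/Y)` drops by at
    -- least `m`.
    by_cases hvB : v ∈ B
    · have h5 := dim_le_delta (n := n) (m := m) hC (X := {v} ∪ Y) (Z := B ∩ P)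
        (hP.subset Set.inter_subset_right) (Set.subset_inter
          (Set.union_subset (Set.singleton_subset_iff.2 hvB) hYB) hPsub)
      rw [hd2 B hBQ (by simpa using hvB) hUB] at hdimB
      linarith
    · have h5 := dim_le_delta (n := n) (m := m) hC (X := Y) (Z := B ∩ P)
        (hP.subset Set.inter_subset_right) (Set.subset_inter hYB hYP)
      rw [hd1 B hBQ (fun h => hvB (h.1 (by simp)))] at hdimB
      refine ih _ ?_ _ hY' (hAY.trans Set.subset_union_left) hY'S rfl
      omega

/-! ### Towers: a point of larger dimension when `k(r-1) < m` -/

variable (n m M A₁ u k) in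
/-- A finite strong set `K`, of dimension `a` over `A₁`, generated by its last point `z`, in which
the points of `Z` have dimension greater than `k` and the copies of `u` outside of `Z` in `U` are
independent. -/
structure IsTower (K Z : Set V) (z : V) (U : Finset V) (a : ℤ) : Prop where
  finite : K.Finite
  isStrong : M.IsStrong n m K
  subset : A₁ ⊆ K
  mem_Z : z ∈ Z
  Z_subset : Z ⊆ K
  U_subset : ↑U ⊆ K
  U_orb : ∀ x ∈ U, x ∈ M.orb (M.dcl n m A₁) u
  delta_eq : M.delta n m K = M.delta n m A₁ + a
  lt : k + 1 ≤ a
  delta_Z : ∀ B : Set V, A₁ ⊆ B → B ⊆ K → (B ∩ Z).Nonempty →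
    M.delta n m A₁ + k + 1 ≤ M.delta n m B
  delta_U : ∀ B : Set V, A₁ ⊆ B → B ⊆ K → ¬ (B ∩ Z).Nonempty →
    M.delta n m A₁ + k * (↑U ∩ B : Set V).ncard ≤ M.delta n m B
  delta_le : ∀ B : Set V, A₁ ⊆ B → B ⊆ K → z ∈ B → M.delta n m K ≤ M.delta n m B

/-- As `z ∈ J ∩ Z`, sets missing `Z` never see the new hyperedge, so the copies remain independent
there. As `k * T ≤ m`, a set containing `J` but not all new copies is no cheaper than the whole, so
`z` still generates. -/
theorem IsTower.attach (hM : M.IsGeneric n m) (hm : 1 ≤ m) (hr : 2 ≤ r)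
    (hA : IsBase n m M A₁ u k) {P Z : Set V} {z : V} {U J : Finset V} {a : ℤ} {T : ℕ}
    (hT : J.card + T = r) (hP : P.Finite) (hPs : M.IsStrong n m P) (hAP : A₁ ⊆ P) (hZP : Z ⊆ P)
    (hzZ : z ∈ Z) (hzJ : z ∈ J) (hJP : ↑J ⊆ P) (hJM : J ∉ M.edges) (hUP : ↑U ⊆ P)
    (hUo : ∀ x ∈ U, x ∈ M.orb (M.dcl n m A₁) u)
    (ha : M.delta n m P + k * T - m = M.delta n m A₁ + a) (hka : k + 1 ≤ a) (hkT : k * T ≤ m)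
    (hZ : ∀ B : Set V, A₁ ⊆ B → B ⊆ P → (B ∩ Z).Nonempty →
      M.delta n m A₁ + k + 1 ≤ M.delta n m B)
    (hU : ∀ B : Set V, A₁ ⊆ B → B ⊆ P → ¬ (B ∩ Z).Nonempty →
      M.delta n m A₁ + k * (↑U ∩ B : Set V).ncard ≤ M.delta n m B)
    (hz : ∀ B : Set V, A₁ ⊆ B → B ⊆ P → z ∈ B → ¬ ↑J ⊆ B → M.delta n m A₁ + a ≤ M.delta n m B)
    (hJ : ∀ B : Set V, A₁ ⊆ B → B ⊆ P → ↑J ⊆ B → M.delta n m P ≤ M.delta n m B) :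
    ∃ (K Z' : Set V) (z' : V) (U' : Finset V), U'.card = U.card + T ∧
      IsTower n m M A₁ u k K Z' z' U' a := by
  classical
  have hkpos := hA.pos
  have hzA : z ∉ A₁ := fun h => by
    have := hZ A₁ subset_rfl hAP ⟨z, h, hzZ⟩
    linarith
  obtain ⟨σ, Q, W, hWT, hWo, hWP, hQ, hPQ, hWQ, hσ, hσs, hδ, hδQ, hd1, hd2, ho⟩ :=
    exists_attach hM hm hr hA (X := A₁) hT hP hPs subset_rfl hAP hA.isStrong hJP
      (fun h => hzA (h hzJ)) hJM (fun B hAB hBP hB => by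
        have := hJ B hAB hBP hB
        linarith)
  have ho' := ho fun B hAB hBP hB => by
    have := hJ B hAB hBP hB
    linarith
  have hσA : σ '' A₁ = A₁ := image_eq_self hσ
  have hAQ : A₁ ⊆ Q := hAP.trans hPQ
  have hdisj : Disjoint U W := Finset.disjoint_left.2 fun x hx hxW => hWP x hxW (hUP hx)
  have hfull : ∀ B : Set V, A₁ ⊆ B → B ⊆ Q → ↑W ⊆ B →
      M.delta n m (B ∩ P) + k * T ≤ M.delta n m B := by
    intro B hAB hBQ hWB
    have h1 := hδ B hAB hBQ
    rwa [Set.inter_eq_left.2 hWB, Set.ncard_coe_finset, hWT] at h1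
  have hge : ∀ B : Set V, A₁ ⊆ B → B ⊆ Q → M.delta n m (B ∩ P) ≤ M.delta n m B :=
    fun B _ hBQ => hPs.delta_inter_le (hQ.subset hBQ)
  have hall : ∀ B : Set V, A₁ ⊆ B → B ⊆ Q → ↑J ⊆ B → ↑W ⊆ B →
      M.delta n m A₁ + a ≤ M.delta n m (σ '' B) := by
    intro B hAB hBQ hJB hWB
    rw [hd2 B hBQ hJB hWB]
    have h1 := hfull B hAB hBQ hWB
    have h2 := hJ (B ∩ P) (Set.subset_inter hAB hAP) Set.inter_subset_right
      (Set.subset_inter hJB hJP)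
    linarith
  have hpull : ∀ B : Set V, A₁ ⊆ B → B ⊆ σ '' Q → ∃ B₀ ⊆ Q, A₁ ⊆ B₀ ∧ σ '' B₀ = B := by
    intro B hAB hB
    obtain ⟨B₀, hB₀, rfl⟩ := Set.subset_image_iff.1 hB
    exact ⟨B₀, hB₀, subset_of_subset_image hσ hAB, rfl⟩
  have hinterP : ∀ B : Set V, (B ∩ P) ∩ Z = B ∩ Z := fun B => by
    rw [Set.inter_assoc, Set.inter_eq_right.2 hZP]
  refine ⟨σ '' Q, σ '' Z, σ z, (U ∪ W).map σ.toEmbedding, ?_, hQ.image σ, hσs, ?_, ⟨z, hzZ, rfl⟩,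
    Set.image_mono (hZP.trans hPQ), ?_, ?_, ?_, hka, ?_, ?_, ?_⟩
  · rw [Finset.card_map, Finset.card_union_of_disjoint hdisj, hWT]
  · rw [← hσA]
    exact Set.image_mono hAQ
  · rw [Finset.coe_map, Finset.coe_union]
    exact Set.image_mono (Set.union_subset (hUP.trans hPQ) hWQ)
  · intro x hx
    obtain ⟨y, hy, rfl⟩ := Finset.mem_map.1 hx
    rcases Finset.mem_union.1 hy with h | h
    · exact ho' y (hPQ (hUP h)) (hUo y h)
    · exact ho' y (hWQ h) (hWo y h)
  · rw [hd2 Q subset_rfl (hJP.trans hPQ) hWQ, hδQ, ha]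
  · intro B' hAB' hB' hne
    obtain ⟨B, hBQ, hAB, rfl⟩ := hpull B' hAB' hB'
    have hne' : ((B ∩ P) ∩ Z).Nonempty := by
      rw [hinterP, ← Set.image_nonempty (f := σ), Set.image_inter σ.injective]
      exact hne
    by_cases h : ↑J ⊆ B ∧ ↑W ⊆ B
    · have := hall B hAB hBQ h.1 h.2
      linarith
    · rw [hd1 B hBQ h]
      exact (hZ _ (Set.subset_inter hAB hAP) Set.inter_subset_right hne').trans (hge B hAB hBQ)
  · intro B' hAB' hB' hne
    obtain ⟨B, hBQ, hAB, rfl⟩ := hpull B' hAB' hB'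
    have hne' : ¬ ((B ∩ P) ∩ Z).Nonempty := by
      rw [hinterP, ← Set.image_nonempty (f := σ), Set.image_inter σ.injective]
      exact hne
    have h1 : ¬ (↑J ⊆ B ∧ ↑W ⊆ B) := fun h =>
      hne ⟨σ z, ⟨z, h.1 hzJ, rfl⟩, z, hzZ, rfl⟩
    rw [hd1 B hBQ h1]
    have h2 := hδ B hAB hBQ
    have h3 := hU _ (Set.subset_inter hAB hAP) Set.inter_subset_right hne'
    have h4 : (↑U ∩ (B ∩ P) : Set V) = ↑U ∩ B := by
      rw [Set.inter_comm B P, ← Set.inter_assoc, Set.inter_eq_left.2 hUP]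
    have h5 : (↑((U ∪ W).map σ.toEmbedding) ∩ σ '' B : Set V).ncard ≤
        (↑U ∩ B : Set V).ncard + (↑W ∩ B : Set V).ncard := by
      rw [Finset.coe_map]
      change (σ '' ↑(U ∪ W) ∩ σ '' B).ncard ≤ _
      rw [← Set.image_inter σ.injective, Set.ncard_image_of_injective _ σ.injective,
        Finset.coe_union, Set.union_inter_distrib_right]
      exact Set.ncard_union_le _ _
    rw [h4] at h3
    have h6 : k * ((↑((U ∪ W).map σ.toEmbedding) ∩ σ '' B : Set V).ncard : ℤ) ≤
        k * ((↑U ∩ B : Set V).ncard + (↑W ∩ B : Set V).ncard : ℤ) :=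
      mul_le_mul_of_nonneg_left (by exact_mod_cast h5) hkpos.le
    rw [mul_add] at h6
    linarith
  · intro B' hAB' hB' hzB'
    obtain ⟨B, hBQ, hAB, rfl⟩ := hpull B' hAB' hB'
    have hzB : z ∈ B := σ.injective.mem_set_image.1 hzB'
    rw [hd2 Q subset_rfl (hJP.trans hPQ) hWQ, hδQ, ha]
    by_cases hJB : ↑J ⊆ B
    · by_cases hWB : ↑W ⊆ B
      · exact hall B hAB hBQ hJB hWB
      · rw [hd1 B hBQ fun h => hWB h.2]
        have h1 := hJ (B ∩ P) (Set.subset_inter hAB hAP) Set.inter_subset_right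
          (Set.subset_inter hJB hJP)
        have h2 := hge B hAB hBQ
        linarith
    · rw [hd1 B hBQ fun h => hJB h.1]
      exact (hz (B ∩ P) (Set.subset_inter hAB hAP) Set.inter_subset_right ⟨hzB, hJP hzJ⟩
        fun h => hJB (h.trans Set.inter_subset_left)).trans (hge B hAB hBQ)

theorem IsTower.exists_initial (hM : M.IsGeneric n m) (hr : 2 ≤ r)
    (hA : IsBase n m M A₁ u k) (hkn : k + 1 ≤ n) :
    ∃ (K Z : Set V) (z : V) (U : Finset V), IsTower n m M A₁ u k K Z z U n := by
  obtain ⟨z, hz, hs, -, hδ⟩ := hM.exists_free_point hr hA.finite hA.isStrong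
  have hδ' : ∀ B : Set V, A₁ ⊆ B → B ⊆ insert z A₁ → z ∈ B →
      M.delta n m B = M.delta n m A₁ + n := fun B hAB hB hzB => by
    rw [hδ B hB hzB, Set.inter_eq_right.2 hAB]
  have hδK := hδ' _ (Set.subset_insert z A₁) subset_rfl (Set.mem_insert z A₁)
  refine ⟨insert z A₁, {z}, z, ∅, hA.finite.insert z, hs, Set.subset_insert _ _, rfl, by simp,
    by simp, by simp, hδK, hkn, ?_, ?_, ?_⟩
  · rintro B hAB hB ⟨_, hzB, rfl⟩
    rw [hδ' B hAB hB hzB]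
    linarith
  · intro B hAB hB _
    simpa using hA.isStrong.delta_le ((hA.finite.insert z).subset hB) hAB
  · intro B hAB hB hzB
    rw [hδ' B hAB hB hzB, hδK]

/-- If `a` is large enough, a hyperedge on `z` and `r-1` copies lowers it but leaves it at least
`k+1`. Otherwise a hyperedge on `z`, a free point and `r-2` copies changes it by `n + k(r-2) - m >
0` without passing `n`, and the step is repeated. For `r = 2` the second move adds no copy, so the
recursion ends with the first. -/
theorem IsTower.exists_succ (hM : M.IsGeneric n m) (hm : 1 ≤ m) (hr : 2 ≤ r) (hmn : m ≤ n)
    (h2 : r = 2 → m < n) (hA : IsBase n m M A₁ u k) {T : ℕ} (hT : T + 1 = r) (hkT : k * T < m)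
    (N : ℕ) : ∀ {K Z : Set V} {z : V} {U : Finset V} {a : ℤ}, IsTower n m M A₁ u k K Z z U a →
      a ≤ n → (k + m + 1 - k * T - a).toNat ≤ N →
      ∃ (K' Z' : Set V) (z' : V) (U' : Finset V) (a' : ℤ), IsTower n m M A₁ u k K' Z' z' U' a' ∧
        a' ≤ n ∧ U.card + 1 ≤ U'.card := by
  classical
  have hk := hA.pos
  -- From here on `r = T + 2`.
  obtain ⟨T, rfl⟩ : ∃ T', T = T' + 1 := ⟨T - 1, by omega⟩
  push_cast at hkT ⊢
  have hkT0 : 0 ≤ k * (T : ℤ) := by positivity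
  have hdrift : (m : ℤ) < n + k * T := by
    by_cases h : r = 2
    · have := h2 h
      zify at this
      linarith
    · have h3 : (1 : ℤ) ≤ T := by
        have : 1 ≤ T := by omega
        exact_mod_cast this
      have h4 : 0 < k * (T : ℤ) := by positivity
      zify at hmn
      linarith
  induction N with
  | zero =>
    intro K Z z U a h han hN
    have hzA : z ∉ A₁ := fun hz => by
      have := h.delta_Z A₁ subset_rfl h.subset ⟨z, hz, h.mem_Z⟩
      linarith
    obtain ⟨K', Z', z', U', hU', h'⟩ := IsTower.attach hM hm hr hA (P := K) (Z := Z) (z := z)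
      (U := U) (J := {z}) (a := a + k * (T + 1) - m) (T := T + 1)
      (by rw [Finset.card_singleton]; omega) h.finite h.isStrong
      h.subset h.Z_subset h.mem_Z (by simp) (by simpa using h.Z_subset h.mem_Z)
      (fun he => by
        have := M.card_eq _ he
        rw [Finset.card_singleton] at this
        omega)
      h.U_subset h.U_orb (by rw [h.delta_eq]; push_cast; ring) (by omega)
      (by push_cast; linarith) h.delta_Z h.delta_U
      (fun B _ _ hzB hn => absurd (by simpa using hzB) hn)
      (fun B hAB hBK hzB => h.delta_le B hAB hBK (by simpa using hzB))
    exact ⟨K', Z', z', U', _, h', by linarith, by omega⟩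
  | succ N ih =>
    intro K Z z U a h han hN
    by_cases hN' : (k + m + 1 - k * (T + 1) - a).toNat ≤ N
    · exact ih h han hN'
    have ha : a + k * T ≤ m := by
      have : 0 < k + m + 1 - k * (T + 1) - a := by omega
      linarith
    have hzA : z ∉ A₁ := fun hz => by
      have := h.delta_Z A₁ subset_rfl h.subset ⟨z, hz, h.mem_Z⟩
      linarith
    obtain ⟨w, hwK, hws, hwe, hδ⟩ := hM.exists_free_point hr h.finite h.isStrong
    have hzK : z ∈ K := h.Z_subset h.mem_Z
    have hzw : z ≠ w := fun h' => hwK (h' ▸ hzK)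
    have hδK : M.delta n m (insert w K) = M.delta n m K + n := by
      rw [hδ _ subset_rfl (Set.mem_insert _ _), Set.inter_eq_right.2 (Set.subset_insert _ _)]
    have hsubK : ∀ B : Set V, B ⊆ insert w K → w ∉ B → B ⊆ K := fun B hB hw x hx =>
      (hB hx).resolve_left fun h' => hw (h' ▸ hx)
    have hδw : ∀ B : Set V, A₁ ⊆ B → B ⊆ insert w K → w ∈ B →
        M.delta n m A₁ + n ≤ M.delta n m B := by
      intro B hAB hB hw
      rw [hδ B hB hw]
      have := hA.isStrong.delta_le (h.finite.subset (Set.inter_subset_right (s := B)))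
        (Set.subset_inter hAB h.subset)
      linarith
    have hkm : k + 1 ≤ m := by
      rw [mul_add] at hkT
      linarith
    zify at hmn
    obtain ⟨K', Z', z', U', hU', h'⟩ := IsTower.attach hM hm hr hA (P := insert w K)
      (Z := insert w Z) (z := w)
      (U := U) (J := {z, w}) (a := a + n + k * T - m) (T := T)
      (by rw [Finset.card_pair hzw]; omega) (h.finite.insert w) hws
      (h.subset.trans (Set.subset_insert _ _)) (Set.insert_subset_insert h.Z_subset)
      (Set.mem_insert _ _) (by simp) (by simp [Set.insert_subset_iff, hzK])
      (fun he => hwe _ he (by simp [Set.insert_subset_iff, hzK]) (by simp))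
      (h.U_subset.trans (Set.subset_insert _ _)) h.U_orb (by rw [hδK, h.delta_eq]; ring)
      (by linarith [h.lt]) (by linarith [h.lt])
      (fun B hAB hB hne => by
        by_cases hw : w ∈ B
        · linarith [hδw B hAB hB hw]
        · refine h.delta_Z B hAB (hsubK B hB hw) ?_
          rwa [Set.inter_insert_of_notMem hw] at hne)
      (fun B hAB hB hne => by
        have hw : w ∉ B := fun hw => hne ⟨w, hw, Set.mem_insert _ _⟩
        rw [Set.inter_insert_of_notMem hw] at hne
        exact h.delta_U B hAB (hsubK B hB hw) hne)
      (fun B hAB hB hw _ => by linarith [hδw B hAB hB hw])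
      (fun B hAB hB hJ => by
        rw [Finset.coe_pair, Set.pair_subset_iff] at hJ
        rw [hδK, hδ B hB hJ.2]
        have := h.delta_le (B ∩ K) (Set.subset_inter hAB h.subset) Set.inter_subset_right
          ⟨hJ.1, hzK⟩
        linarith)
    obtain ⟨K'', Z'', z'', U'', a'', h1, h2, h3⟩ := ih h' (by linarith) (by omega)
    exact ⟨K'', Z'', z'', U'', a'', h1, h2, by omega⟩

/-- Take a tower with at least `n + 1` copies. If the closure of `A₁` and the copies missed `Z`,
their independence would give dimension above `n ≥ a` over `A₁`, more than the whole tower has. -/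
theorem IsBase.exists_mem_dim_gt (hM : M.IsGeneric n m) (hm : 1 ≤ m) (hr : 2 ≤ r) (hmn : m ≤ n)
    (h2 : r = 2 → m < n) (hA : IsBase n m M A₁ u k) {S : Set V} (hS : M.dcl n m S ⊆ S)
    (hAS : A₁ ⊆ S) (horb : M.orb (M.dcl n m A₁) u ⊆ S) {T : ℕ} (hT : T + 1 = r)
    (hkT : k * T < m) :
    ∃ x ∈ S, M.delta n m A₁ + k + 1 ≤ M.dim n m ({x} ∪ A₁) := by
  have hC := hM.memC0
  have hk := hA.pos
  have hkn : k + 1 ≤ n := by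
    have h1 : (1 : ℤ) ≤ T := by
      have : 1 ≤ T := by omega
      exact_mod_cast this
    have h2 : k * 1 ≤ k * T := mul_le_mul_of_nonneg_left h1 hk.le
    zify at hmn
    linarith
  have hex : ∀ t : ℕ, ∃ (K Z : Set V) (z : V) (U : Finset V) (a : ℤ),
      IsTower n m M A₁ u k K Z z U a ∧ a ≤ n ∧ t ≤ U.card := by
    intro t
    induction t with
    | zero =>
      obtain ⟨K, Z, z, U, h⟩ := IsTower.exists_initial hM hr hA hkn
      exact ⟨K, Z, z, U, n, h, le_rfl, Nat.zero_le _⟩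
    | succ t ih =>
      obtain ⟨K, Z, z, U, a, h, ha, ht⟩ := ih
      obtain ⟨K', Z', z', U', a', h', ha', hU'⟩ :=
        IsTower.exists_succ hM hm hr hmn h2 hA hT hkT _ h ha le_rfl
      exact ⟨K', Z', z', U', a', h', ha', by omega⟩
  obtain ⟨K, Z, z, U, a, h, ha, hU⟩ := hex (n + 1)
  have hsub : A₁ ∪ ↑U ⊆ K := Set.union_subset h.subset h.U_subset
  have hf : (A₁ ∪ ↑U).Finite := hA.finite.union U.finite_toSet
  have hQK := cl0_subset h.isStrong hsub
  have hQsub : A₁ ∪ ↑U ⊆ M.cl0 n m (A₁ ∪ ↑U) := subset_cl0 _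
  have hne : (M.cl0 n m (A₁ ∪ ↑U) ∩ Z).Nonempty := by
    by_contra hne
    have h1 := h.delta_U _ (Set.subset_union_left.trans hQsub) hQK hne
    have h3 := dim_le_delta (n := n) (m := m) hC h.finite hsub
    rw [Set.inter_eq_left.2 (Set.subset_union_right.trans hQsub), Set.ncard_coe_finset] at h1
    rw [h.delta_eq] at h3
    have h4 : M.dim n m (A₁ ∪ ↑U) = M.delta n m (M.cl0 n m (A₁ ∪ ↑U)) := rfl
    have h5 : (1 : ℤ) * U.card ≤ k * U.card :=
      mul_le_mul_of_nonneg_right hk (Int.natCast_nonneg _)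
    zify at hU
    linarith
  obtain ⟨x, hxQ, hxZ⟩ := hne
  have hUS : A₁ ∪ ↑U ⊆ S := Set.union_subset hAS fun y hy => horb (h.U_orb y hy)
  refine ⟨x, hS (dcl_mono hC hUS (cl0_subset_dcl hC hf hxQ)), ?_⟩
  have hxA : {x} ∪ A₁ ⊆ M.cl0 n m ({x} ∪ A₁) := subset_cl0 _
  exact h.delta_Z _ (Set.subset_union_right.trans hxA) (cl0_subset h.isStrong
    (Set.union_subset (Set.singleton_subset_iff.2 (h.Z_subset hxZ)) h.subset))
    ⟨x, hxA (Or.inl rfl), hxZ⟩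

/-- Join `v` to a free point by a hyperedge, with no copies of `u` (`T = 0`). The result has
dimension `p + n - m` over `A₁`; since `p ≤ m`, the new point does no better without `v`, so `v` is
dependent on it. -/
theorem IsBase.exists_join (hM : M.IsGeneric n m) (hm : 1 ≤ m) (hr : r = 2) (hmn : m ≤ n)
    (hA : IsBase n m M A₁ u k) {v : V} {p : ℤ} (hv : v ∉ A₁)
    (hp : M.dim n m ({v} ∪ A₁) = M.delta n m A₁ + p) (hpm : p ≤ m) :
    ∃ y, v ∈ M.dcl n m ({y} ∪ A₁) ∧
      M.dim n m ({y} ∪ A₁) = M.delta n m A₁ + (p + n - m) := by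
  classical
  have hC := hM.memC0
  zify at hmn
  have hvA : ({v} ∪ A₁).Finite := (Set.finite_singleton v).union hA.finite
  obtain ⟨hX, hXs, -⟩ := cl0_spec (n := n) (m := m) hC hvA
  have hXsub : {v} ∪ A₁ ⊆ M.cl0 n m ({v} ∪ A₁) := subset_cl0 _
  have hXδ : M.delta n m (M.cl0 n m ({v} ∪ A₁)) = M.delta n m A₁ + p := hp
  set X := M.cl0 n m ({v} ∪ A₁)
  have hvX : v ∈ X := hXsub (Or.inl rfl)
  have hAX : A₁ ⊆ X := Set.subset_union_right.trans hXsub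
  obtain ⟨z, hzX, hzs, hze, hδz⟩ := hM.exists_free_point (by omega) hX hXs
  have hvz : v ≠ z := fun h => hzX (h ▸ hvX)
  have hδP : M.delta n m (insert z X) = M.delta n m A₁ + p + n := by
    rw [hδz _ subset_rfl (Set.mem_insert _ _), Set.inter_eq_right.2 (Set.subset_insert _ _), hXδ]
  obtain ⟨σ, Q, U, hUT, -, -, hQ, hPQ, hUQ, hσ, hσs, -, hδQ, hd1, hd2, -⟩ :=
    exists_attach hM hm (by omega) hA (P := insert z X) (X := X) (J := {v, z}) (T := 0)
      (by rw [Finset.card_pair hvz, hr]) (hX.insert z) hzs hAX (Set.subset_insert _ _) hXs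
      (by simp [Set.insert_subset_iff, hvX])
      (fun h => hv (h (by simp)))
      (fun he => hze _ he (by simp [Set.insert_subset_iff, hvX]) (by simp))
      (fun B hXB hB hJ => by
        rw [Finset.coe_pair, Set.pair_subset_iff] at hJ
        rw [hδz B hB hJ.2, Set.inter_eq_right.2 hXB]
        simpa using hmn)
  obtain rfl : U = ∅ := Finset.card_eq_zero.1 hUT
  have hXQ : X ⊆ Q := (Set.subset_insert _ _).trans hPQ
  have hzQ : z ∈ Q := hPQ (Set.mem_insert _ _)
  have hσA : σ '' A₁ = A₁ := image_eq_self fun x hx => hσ x (hAX hx)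
  have hδσQ : M.delta n m (σ '' Q) = M.delta n m A₁ + (p + n - m) := by
    rw [hd2 Q subset_rfl (by rw [Finset.coe_pair]; exact Set.pair_subset (hXQ hvX) hzQ) (by simp),
      hδQ, hδP]
    push_cast
    ring
  have hyAQ : {σ z} ∪ A₁ ⊆ σ '' Q := by
    rw [← hσA, ← Set.image_singleton, ← Set.image_union]
    exact Set.image_mono (Set.union_subset (Set.singleton_subset_iff.2 hzQ) (hAX.trans hXQ))
  have hge : M.delta n m A₁ + (p + n - m) ≤ M.dim n m ({σ z} ∪ A₁) := by
    obtain ⟨B, hBQ, hB⟩ := Set.subset_image_iff.1 (cl0_subset hσs hyAQ)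
    have hzAB : {z} ∪ A₁ ⊆ B := by
      rw [← Set.image_subset_image_iff σ.injective, hB, Set.image_union, Set.image_singleton, hσA]
      exact subset_cl0 _
    have hzB : z ∈ B := hzAB (Or.inl rfl)
    have hAB : A₁ ⊆ B := Set.subset_union_right.trans hzAB
    have h1 := hzs.delta_inter_le (n := n) (m := m) (hQ.subset hBQ)
    rw [hδz _ Set.inter_subset_right ⟨hzB, Set.mem_insert _ _⟩, Set.inter_assoc,
      Set.inter_eq_right.2 (Set.subset_insert z X)] at h1
    have hBX := hX.subset (Set.inter_subset_right (s := B))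
    have h2 : M.dim n m ({σ z} ∪ A₁) = M.delta n m (σ '' B) := by
      rw [hB]
      rfl
    rw [h2]
    by_cases hvB : v ∈ B
    · have h3 := dim_le_delta (n := n) (m := m) hC (X := {v} ∪ A₁) hBX
        (Set.union_subset (Set.singleton_subset_iff.2 ⟨hvB, hvX⟩) (Set.subset_inter hAB hAX))
      rw [hd2 B hBQ (by rw [Finset.coe_pair]; exact Set.pair_subset hvB hzB) (by simp)]
      linarith
    · have h3 := hA.isStrong.delta_le hBX (Set.subset_inter hAB hAX)
      rw [hd1 B hBQ fun h => hvB (h.1 (by simp))]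
      linarith
  have hyA : ({σ z} ∪ A₁).Finite := (Set.finite_singleton _).union hA.finite
  refine ⟨σ z, mem_dcl_of_dim_le hC hyA ?_, le_antisymm ?_ hge⟩
  · refine le_trans ?_ hge
    rw [← hδσQ]
    refine dim_le_delta hC (hQ.image σ) (Set.union_subset ?_ hyAQ)
    exact Set.singleton_subset_iff.2 ⟨v, hXQ hvX, hσ v hvX⟩
  · rw [← hδσQ]
    exact dim_le_delta hC (hQ.image σ) hyAQ

theorem delta_singleton_union_le (hC : M.MemC0 n m) {x : V} {X : Set V}
    (hX : X.Finite) : M.delta n m ({x} ∪ X) ≤ M.delta n m X + n := by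
  have h1 := M.delta_submodular (n := n) (m := m) (Set.finite_singleton x) hX
  have h2 := hC ({x} ∩ X) ((Set.finite_singleton x).subset Set.inter_subset_left)
  have h3 : M.delta n m {x} ≤ n := by
    have : (0 : ℤ) ≤ m * (M.edgesIn {x}).ncard := by positivity
    rw [delta, Set.ncard_singleton]
    push_cast
    linarith
  linarith

theorem dim_singleton_union_le (hC : M.MemC0 n m) {x : V} {X : Set V}
    (hX : X.Finite) : M.dim n m ({x} ∪ X) ≤ M.dim n m X + n := by
  have h := (cl0_spec (n := n) (m := m) hC hX).1
  refine (dim_le_delta hC ((Set.finite_singleton x).union h)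
    (Set.union_subset_union_right _ (subset_cl0 X))).trans ?_
  exact delta_singleton_union_le hC h

/-- Everything is in the `d`-closure once a copy of a point of maximal dimension is. -/
theorem IsBase.eq_univ (hM : M.IsGeneric n m) (hm : 1 ≤ m) (hr : 2 ≤ r) (hmn : m ≤ n)
    (h2 : r = 2 → m < n) (hA : IsBase n m M A₁ u k) {S : Set V} (hS : M.dcl n m S ⊆ S)
    (hAS : A₁ ⊆ S) (horb : M.orb (M.dcl n m A₁) u ⊆ S)
    (hmax : ∀ x ∈ S, M.dim n m ({x} ∪ A₁) ≤ M.delta n m A₁ + k) : S = Set.univ := by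
  have hC := hM.memC0
  have hk := hA.pos
  obtain ⟨T, hT⟩ : ∃ T, T + 1 = r := ⟨r - 1, by omega⟩
  -- Otherwise a tower contradicts the maximality of `k`.
  have hkT : (m : ℤ) ≤ k * T := by
    by_contra h
    obtain ⟨x, hx, hx'⟩ := hA.exists_mem_dim_gt hM hm hr hmn h2 hS hAS horb hT (not_le.1 h)
    linarith [hmax x hx]
  have hAdim := dim_eq_delta hA.isStrong
  have hrank : ∀ v ∉ S, M.delta n m A₁ < M.dim n m ({v} ∪ A₁) := by
    intro v hv
    by_contra h
    refine hv (hS (dcl_mono hC hAS (mem_dcl_of_dim_le hC hA.finite ?_)))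
    rw [hAdim]
    exact not_lt.1 h
  zify at hmn
  by_cases hr2 : r = 2
  · obtain rfl : T = 1 := by omega
    have hmn' := h2 hr2
    zify at hmn'
    push_cast at hkT
    -- With `T = 1` the condition of `mem_of_dim_eq` is that `v` has dimension at least `m` over
    -- `A₁`; joining lowers the deficit by `n - m > 0`.
    suffices h : ∀ N : ℕ, ∀ v : V,
        (M.delta n m A₁ + m - M.dim n m ({v} ∪ A₁)).toNat ≤ N → v ∈ S from
      Set.eq_univ_of_forall fun v => h _ v le_rfl
    intro N
    induction N with
    | zero =>
      intro v hv
      refine hA.mem_of_dim_eq hM hm hr hS hAS horb (T := 1) (v := v)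
        (p := M.dim n m ({v} ∪ A₁) - M.delta n m A₁) (by omega) (by ring) (by simpa using hkT) ?_
      push_cast
      have : M.delta n m A₁ + m - M.dim n m ({v} ∪ A₁) ≤ 0 := by omega
      linarith
    | succ N ih =>
      intro v hv
      by_contra hvS
      by_cases hv' : (M.delta n m A₁ + m - M.dim n m ({v} ∪ A₁)).toNat ≤ N
      · exact hvS (ih v hv')
      obtain ⟨y, hy, hyd⟩ := hA.exists_join hM hm hr2 (by exact_mod_cast hmn)
        (v := v) (p := M.dim n m ({v} ∪ A₁) - M.delta n m A₁) (fun h => hvS (hAS h)) (by ring)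
        (by omega)
      have hyS : y ∈ S := ih y (by omega)
      exact hvS (hS (dcl_mono hC (Set.union_subset (Set.singleton_subset_iff.2 hyS) hAS) hy))
  · have hT2 : (2 : ℤ) ≤ T := by
      have : 2 ≤ T := by omega
      exact_mod_cast this
    obtain ⟨z, -, hzs, -, hδz⟩ := hM.exists_free_point hr hA.finite hA.isStrong
    have hzd : M.dim n m ({z} ∪ A₁) = M.delta n m A₁ + n := by
      rw [Set.singleton_union, dim_eq_delta hzs, hδz _ subset_rfl (Set.mem_insert _ _),
        Set.inter_eq_right.2 (Set.subset_insert _ _)]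
    have h2k : k * 2 ≤ k * T := mul_le_mul_of_nonneg_left hT2 hk.le
    -- The free point qualifies because `m ≤ n` and `k ≤ k * T`. It forces `k ≥ n`, whence `k * T ≥
    -- 2k ≥ k + m` and no lower bound on the dimension of `v` beyond positivity is needed.
    have hzS : z ∈ S := by
      refine hA.mem_of_dim_eq hM hm hr hS hAS horb (T := T) (by omega) hzd hkT ?_
      linarith
    have hkn : (n : ℤ) ≤ k := by
      have := hmax z hzS
      linarith
    refine Set.eq_univ_of_forall fun v => ?_
    by_contra hv
    refine hv (hA.mem_of_dim_eq hM hm hr hS hAS horb (T := T) (v := v)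
      (p := M.dim n m ({v} ∪ A₁) - M.delta n m A₁) (by omega) (by ring) hkT ?_)
    linarith [hrank v hv]

/-- The point `u₀` is replaced by a point `u ∈ S` of maximal dimension over `X`, to which
`IsBase.eq_univ` applies. -/
theorem IsGeneric.dcl_union_orb_eq_univ (hM : M.IsGeneric n m) (hm : 1 ≤ m) (hr : 2 ≤ r)
    (hmn : m ≤ n) (h2 : r = 2 → m < n) {X : Set V} (hX : X.Finite) {u₀ : V}
    (hu₀ : u₀ ∉ M.dcl n m X) :
    M.dcl n m (M.dcl n m X ∪ M.orb (M.dcl n m X) u₀) = Set.univ := by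
  have hC := hM.memC0
  set A := M.dcl n m X with hAdef
  set S := M.dcl n m (A ∪ M.orb A u₀) with hSdef
  have hS : M.dcl n m S ⊆ S := dcl_dcl hC _
  have hAS : A ⊆ S := Set.subset_union_left.trans (subset_dcl hC _)
  have hu₀S : u₀ ∈ S := subset_dcl hC _ (Or.inr (mem_orb_self A u₀))
  obtain ⟨d, ⟨u, huS, hud⟩, hdmax⟩ := Int.exists_greatest_of_bdd
    (P := fun d => ∃ x ∈ S, M.dim n m ({x} ∪ X) = d)
    ⟨M.dim n m X + n, by
      rintro _ ⟨x, -, rfl⟩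
      exact dim_singleton_union_le hC hX⟩
    ⟨_, u₀, hu₀S, rfl⟩
  have hd : M.dim n m X < d := by
    refine lt_of_lt_of_le ?_ (hdmax _ ⟨u₀, hu₀S, rfl⟩)
    by_contra h
    exact hu₀ (mem_dcl_of_dim_le hC hX (not_lt.1 h))
  have huX : ({u} ∪ X).Finite := (Set.finite_singleton u).union hX
  obtain ⟨hE, hEs, -⟩ := cl0_spec (n := n) (m := m) hC huX
  have hEsub : {u} ∪ X ⊆ M.cl0 n m ({u} ∪ X) := subset_cl0 _
  -- Enlarging `X` to `A₁` changes neither its `d`-closure nor dimensions over it, but now the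
  -- closure of `u` over the base meets `A` only in the base.
  set A₁ := M.cl0 n m ({u} ∪ X) ∩ A with hA₁
  have hA₁f : A₁.Finite := hE.subset Set.inter_subset_left
  have hA₁s : M.IsStrong n m A₁ := isStrong_inter_dcl hC hE hEs
  have hXA₁ : X ⊆ A₁ := Set.subset_inter (Set.subset_union_right.trans hEsub) (subset_dcl hC X)
  have hA₁A : A₁ ⊆ A := Set.inter_subset_right
  have hdcl : M.dcl n m A₁ = A :=
    (dcl_subset_dcl hC hA₁A).antisymm (dcl_mono hC hXA₁)
  have hdA₁ : M.delta n m A₁ = M.dim n m X := by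
    rw [← dim_eq_delta hA₁s, ← dim_union_eq_of_subset_dcl hC hA₁f hX hA₁A,
      Set.union_eq_left.2 hXA₁]
  have hdim : ∀ x, M.dim n m ({x} ∪ A₁) = M.dim n m ({x} ∪ X) := by
    intro x
    have h1 : ({x} ∪ X).Finite := (Set.finite_singleton x).union hX
    rw [← dim_union_eq_of_subset_dcl hC hA₁f h1
      (hA₁A.trans (dcl_mono hC Set.subset_union_right))]
    congr 1
    rw [Set.union_left_comm, Set.union_eq_left.2 hXA₁]
  have hbase : IsBase n m M A₁ u (d - M.dim n m X) :=
    { finite := hA₁f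
      isStrong := hA₁s
      pos := by linarith
      dim_eq := by
        rw [hdim, hdA₁, hud]
        ring
      inter_subset := by
        rw [hdcl]
        refine Set.inter_subset_inter_left _ (cl0_subset hEs (Set.union_subset ?_
          Set.inter_subset_left))
        exact Set.subset_union_left.trans hEsub }
  refine hbase.eq_univ hM hm hr hmn h2 hS (hA₁A.trans hAS) ?_ ?_
  -- An automorphism fixing `A` permutes the orbit of `u₀`, so it maps `S` into itself.
  · rw [hdcl]
    rintro _ ⟨g, hg, hgA, rfl⟩
    refine dcl_mono hC ?_ (hg.mem_dcl hC huS)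
    rintro _ ⟨x, hx | ⟨g', hg', hg'A, rfl⟩, rfl⟩
    · rw [hgA x hx]
      exact Or.inl hx
    · exact Or.inr ⟨g'.trans g, hg'.trans hg, fun a ha => by
        rw [Equiv.trans_apply, hg'A a ha, hgA a ha], rfl⟩
  · intro x hx
    rw [hdim, hdA₁]
    have := hdmax _ ⟨x, hx, rfl⟩
    linarith

end Spanning

end UniformHypergraph

theorem lemma4p11 (r n m : ℕ) (hr : 2 ≤ r) (hn : 1 ≤ n) (hm : 1 ≤ m) (hcop : Nat.Coprime n m)
    (h2 : r = 2 → m < n) (h3 : 3 ≤ r → m ≤ n)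
    {V : Type*} (M : UniformHypergraph r V) (hM : M.IsGeneric n m) :
    (∀ A ∈ M.finDcl n m, ∀ u₀ : V, M.IsBasic n m A u₀ →
      M.dcl n m (A ∪ M.orb A u₀) = Set.univ) ∧
    M.Monodimensional n m := by
  have hmn : m ≤ n := by
    by_cases h : r = 2
    · exact (h2 h).le
    · exact h3 (by omega)
  have key : ∀ A ∈ M.finDcl n m, ∀ u₀ : V, M.IsBasic n m A u₀ →
      M.dcl n m (A ∪ M.orb A u₀) = Set.univ := by
    rintro _ ⟨X, hX, rfl⟩ u₀ hu₀
    exact hM.dcl_union_orb_eq_univ hm hr hmn h2 hX hu₀.1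
  exact ⟨key, fun A hA b hb => ⟨A, hA, subset_rfl, key A hA b hb⟩⟩
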